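/- **Theorem 5.** A rooted graph $(G,H)$ is a finite graph $H$ together with an induced subgraph $G\subseteq H$ whose vertices are labelled as roots $1,\dots,v_G$; assume $e_H>e_G$, where $v_F$ and $e_F$ denote the numbers of vertices and edges of a graph $F$. Let $p=p(n)\in[0,1]$ and let $\mathbb{G}_{n,p}$ be the binomial random graph on $[n]=\{1,\dots,n\}$. For a tuple $x=(x_1,\dots,x_{v_G})$ of distinct vertices of $[n]$, let $X_x$ be the number of $(G,H)$-extensions of $x$ in $\mathbb{G}_{n,p}$, i.e. of subgraphs of $\mathbb{G}_{n,p}$ that are copies of the graph $(V(H),E(H)\setminus E(G))$ in which each root $j$ is mapped onto $x_j$. Let $\mu=\mu_{G,H}=\mathbb{E}X_x$, which does not depend on $x$, and let $$\Phi=\Phi_{G,H}=\min_{G\subseteq J\subseteq H:\ e_J>e_G}\mu_{G,J}.$$ Below, $\max_x$ is over all such tuples $x$, and all limits and asymptotic notation refer to $n\to\infty$ with $(G,H)$ fixed. Then the following holds. (i) Let $t=t(n)\ge 0$. If $\Phi=\Omega(1)$ and $(t/\mu)^2\Phi\ge n^{\Omega(1)}$ (that is, there are constants $c,c'>0$ such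 that $\Phi\ge c$ and $(t/\mu)^2\Phi\ge n^{c'}$ for all sufficiently large $n$), then $$\lim_{n\to\infty}\Pr\Bigl(\max_x|X_x-\mu|<t\Bigr)=1,$$ and in fact $\Pr\bigl(\max_x|X_x-\mu|<t\bigr)=1-o(n^{-\tau})$ for every constant $\tau>0$. (ii) Let $\varepsilon=\varepsilon(n)\in(0,1]$. If either (a) $\Phi(1-p)\to\infty$ and $\varepsilon^2\Phi/(1-p)\to 0$, or (b) $\Phi\to 0$, then $$\lim_{n\to\infty}\Pr\Bigl(\max_x|X_x-\mu|\ge\varepsilon\mu\Bigr)=1.$$ -/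

import Mathlib

open MeasureTheory Filter Topology

/-- A rooted graph `(G, H)` with `k` labelled roots: a graph `H` on the vertex set `V`, together
with distinct vertices `root 0, …, root (k - 1)` of `H`. The graph `G` is the subgraph of `H`
induced by the roots. -/
structure RootedGraph (k : ℕ) (V : Type*) where
  /-- The graph `H`. -/
  graph : SimpleGraph V
  /-- The labelled roots, i.e. the vertices of `G`. -/
  root : Fin k ↪ V

namespace RootedGraph

/-- The graph `G`: the subgraph of `H` induced by the roots. -/
def rootGraph {k : ℕ} {V : Type*} (F : RootedGraph k V) : F.graph.Subgraph :=
  (⊤ : F.graph.Subgraph).induce (Set.range F.root)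

/-- The graph `H_G = (V(H), E(H) \ E(G))`. -/
def extGraph {k : ℕ} {V : Type*} (F : RootedGraph k V) : SimpleGraph V :=
  F.graph.deleteEdges F.rootGraph.edgeSet

/-- The rooted graph `(G, J)`, for a subgraph `J` with `G ⊆ J ⊆ H`. -/
def restrict {k : ℕ} {V : Type*} (F : RootedGraph k V) (J : F.graph.Subgraph)
    (hJ : F.rootGraph ≤ J) : RootedGraph k J.verts where
  graph := J.coe
  root := ⟨fun j => ⟨F.root j, hJ.1 (Set.mem_range_self j)⟩, fun _ _ h =>
    F.root.injective (congrArg Subtype.val h)⟩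

/-- The `(G, H)`-extensions of the tuple `x` in a graph `Γ`: the subgraphs `K` of `Γ` that are
copies of `H_G` in which each root `j` is mapped onto `x j`. -/
def extensions {k : ℕ} {V W : Type*} (F : RootedGraph k V) (Γ : SimpleGraph W)
    (x : Fin k ↪ W) : Set Γ.Subgraph :=
  {K | ∃ φ : F.extGraph ≃g K.coe, ∀ j, (φ (F.root j) : W) = x j}

/-- `X_x`: the number of `(G, H)`-extensions of `x` in `Γ`. -/
noncomputable def count {k : ℕ} {V W : Type*} (F : RootedGraph k V) (Γ : SimpleGraph W)
    (x : Fin k ↪ W) : ℕ :=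
  (F.extensions Γ x).ncard

/-- The expectation of `X_x` in the binomial random graph `G(n, p)`. -/
noncomputable def expectation {k : ℕ} {V : Type*} (F : RootedGraph k V) (n : ℕ)
    (p : unitInterval) (x : Fin k ↪ Fin n) : ℝ :=
  ∫ Γ, (F.count Γ x : ℝ) ∂(SimpleGraph.binomialRandom (Fin n) p)

/-- `μ_{G,H}`: the expectation of `X_x` in `G(n, p)`. It is the same for all `x`
(see `expectation_eq_mu` below), so it is defined through `x = (1, …, k)`; if `n < k`, then there
is no such tuple, and the value is set to `0`. -/
noncomputable def mu {k : ℕ} {V : Type*} (F : RootedGraph k V) (n : ℕ) (p : unitInterval) : ℝ :=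
  if h : k ≤ n then F.expectation n p (Fin.castLEEmb h) else 0

/-- `Φ_{G,H}`: the minimum of `μ_{G,J}` over all subgraphs `J` with `G ⊆ J ⊆ H` and
`e_J > e_G`. -/
noncomputable def Phi {k : ℕ} {V : Type*} (F : RootedGraph k V) (n : ℕ) (p : unitInterval) : ℝ :=
  sInf {m : ℝ | ∃ (J : F.graph.Subgraph) (hJ : F.rootGraph ≤ J),
    F.rootGraph.edgeSet.ncard < J.edgeSet.ncard ∧ m = (F.restrict J hJ).mu n p}

/-- `max_x |X_x - μ|`, the maximum over all `k`-tuples `x` of distinct vertices of `Γ`. -/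
noncomputable def maxDeviation {k : ℕ} {V : Type*} (F : RootedGraph k V) (n : ℕ)
    (p : unitInterval) (Γ : SimpleGraph (Fin n)) : ℝ :=
  ⨆ x : Fin k ↪ Fin n, |(F.count Γ x : ℝ) - F.mu n p|

end RootedGraph

theorem measurableSet_simpleGraph {n : ℕ} (s : Set (SimpleGraph (Fin n))) : MeasurableSet s := by
  have : s = SimpleGraph.edgeSet ⁻¹' (SimpleGraph.edgeSet '' s) :=
    (Set.preimage_image_eq s SimpleGraph.edgeSet_injective).symm
  rw [this]
  exact SimpleGraph.measurable_edgeSet (Set.toFinite _).measurableSet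

namespace RootedGraph

theorem count_le_of_iso {k : ℕ} {V W W' : Type*} [Finite W'] (F : RootedGraph k V)
    {Γ : SimpleGraph W} {Γ' : SimpleGraph W'} (e : Γ ≃g Γ') (x : Fin k ↪ W) :
    F.count Γ x ≤ F.count Γ' (x.trans e.toEquiv.toEmbedding) := by
  unfold count
  refine Set.ncard_le_ncard_of_injOn (SimpleGraph.Subgraph.map e.toHom) ?_ ?_ ?_
  · rintro K ⟨φ, hφ⟩
    let ψ : K.coe ≃g (K.map e.toHom).coe :=
      { toEquiv := e.toEquiv.image K.verts
        map_rel_iff' := by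
          intro a b
          simp only [SimpleGraph.Subgraph.coe_adj, SimpleGraph.Subgraph.map_adj, Relation.Map]
          constructor
          · rintro ⟨c, d, h, hc, hd⟩
            have h1 : c = a := e.injective hc
            have h2 : d = b := e.injective hd
            exact h1 ▸ h2 ▸ h
          · intro h
            exact ⟨a, b, h, rfl, rfl⟩ }
    refine ⟨φ.trans ψ, fun j => ?_⟩
    change e (φ (F.root j) : W) = e (x j)
    rw [hφ j]
  · intro K _ L _ h
    have h1 := congrArg (SimpleGraph.Subgraph.comap e.toHom) h
    have hc : ∀ M : Γ.Subgraph, (M.map e.toHom).comap e.toHom = M := by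
      intro M
      ext a b
      · exact e.injective.mem_set_image
      · simp only [SimpleGraph.Subgraph.comap_adj, SimpleGraph.Subgraph.map_adj, Relation.Map]
        constructor
        · rintro ⟨_, c, d, h, hc, hd⟩
          have h1 : c = a := e.injective hc
          have h2 : d = b := e.injective hd
          exact h1 ▸ h2 ▸ h
        · intro h
          exact ⟨M.adj_sub h, a, b, h, rfl, rfl⟩
    rwa [hc, hc] at h1
  · exact Set.toFinite _

theorem expectation_congr {k : ℕ} {V : Type*} (F : RootedGraph k V) (n : ℕ)
    (p : unitInterval) (x y : Fin k ↪ Fin n) : F.expectation n p x = F.expectation n p y := by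
  classical
  have hmp : MulAction.IsMultiplyPretransitive (Equiv.Perm (Fin n)) (Fin n) k :=
    Equiv.Perm.isMultiplyPretransitive (Fin n) k
  obtain ⟨σ, hσ⟩ := hmp.exists_smul_eq x y
  have hxy : x.trans σ.toEmbedding = y := by
    rw [← hσ]; rfl
  have hcount : ∀ Γ : SimpleGraph (Fin n),
      F.count Γ x = F.count (Γ.map σ) y := by
    intro Γ
    apply le_antisymm
    · have := F.count_le_of_iso (SimpleGraph.Iso.map σ Γ) x
      exact this.trans_eq (congrArg _ hxy)
    · have := F.count_le_of_iso (SimpleGraph.Iso.map σ Γ).symm y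
      refine this.trans_eq (congrArg _ ?_)
      ext j
      simp [← hxy]
  have : MeasurableSingletonClass (SimpleGraph (Fin n)) := ⟨fun _ => measurableSet_simpleGraph _⟩
  unfold expectation
  rw [integral_fintype (.of_finite), integral_fintype (.of_finite)]
  refine Fintype.sum_equiv (Equiv.simpleGraph σ) _ _ fun Γ => ?_
  have hm : Equiv.simpleGraph σ Γ = Γ.map σ := SimpleGraph.comap_symm Γ σ
  have hc : (Γ.map σ).edgeSet.ncard = Γ.edgeSet.ncard := by
    have := Nat.card_congr (SimpleGraph.Iso.map σ Γ).mapEdgeSet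
    rw [Nat.card_coe_set_eq, Nat.card_coe_set_eq] at this
    exact this.symm
  rw [hm, hcount Γ, measureReal_def, measureReal_def, SimpleGraph.binomialRandom_singleton,
    SimpleGraph.binomialRandom_singleton, hc]

/-- The expectation of `X_x` does not depend on `x`. -/
theorem expectation_eq_mu {k : ℕ} {V : Type*} (F : RootedGraph k V) (n : ℕ)
    (p : unitInterval) (x : Fin k ↪ Fin n) : F.expectation n p x = F.mu n p := by
  have h : k ≤ n := by simpa using Fintype.card_le_of_embedding x
  rw [mu, dif_pos h]
  exact F.expectation_congr n p _ _
end RootedGraph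

/-! Fix a tuple x. Each extension of x is the image of exactly a injective placements φ of V(H)
respecting the roots, where a is the number of root-fixing automorphisms of H_G. Hence a(X_x − μ) =
W, the sum over φ of the centred indicators of "A_φ ⊆ B", where A_φ is the edge set of the image and
B the random edge set. Most of the probability is done for an arbitrary finite family of sets A_i
and a random subset B, with M = ∑ p^|A_i|.

Dependence is measured by one number D (`IntersectionBound`): given that a bounded set U lies in B,
the expected number of A_i in B that meet U is at most D. Up to constants, Φ is the minimum of
n^f(E) p^|E| over nonempty sets E of edges of H_G, with f(E) the number of non-roots covered by E.
Sorting placements by the set E of edges that land in U gives D = O(μ/Φ); placements that agree on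
an optimal E give Var W ≥ const · (1 − p) μ²/Φ (`intersectionBound`, `le_variance`).

Concentration: expand E W^(2m). A product of centred indicators has mean zero unless each of its
sets meets another one, and then some at most m of the sets meet all the rest. Choosing the
dominating sets costs M + D each and the others D each, so E W^(2m) ≤ (16 (M + D) D)^m = O((μ²/Φ)^m)
when Φ is bounded below (`bern_sum_cen_pow_le`). Markov's inequality with a large constant m beats
the union bound over at most n^k tuples.

Deviation when Φ(1 − p) → ∞: one tuple suffices. Stein's method with the test function
2h·arctan(x/h), h = δs, where s is the standard deviation of W, bounds P(|W| ≤ δs) by 4δ + O((1 − p)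
M D²/(δ s³)) (`bern_small_ball_le`). With the bounds for D and s, the error is O(1/(δ √(Φ(1 − p)))),
and aεμ ≤ δs follows from the smallness of ε²Φ/(1 − p).

Deviation when Φ → 0: by Markov's inequality for the J that attains Φ, a fixed tuple has no
extension with high probability, and then |X_x − μ| = μ ≥ εμ. -/

section RandomSubset

/-! ### Expectations over a random subset and products of centred indicators. -/

variable {α : Type*}

/-- The expectation of `f B`, where `B` is a random subset of `S` that contains each element of `S`
independently with probability `p`. -/
noncomputable def bern (p : ℝ) (S : Finset α) (f : Finset α → ℝ) : ℝ :=
  ∑ B ∈ S.powerset, p ^ B.card * (1 - p) ^ (S.card - B.card) * f B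

theorem bern_const (p : ℝ) (S : Finset α) (c : ℝ) : bern p S (fun _ => c) = c := by
  unfold bern
  rw [← Finset.sum_mul, Finset.sum_pow_mul_eq_add_pow]
  simp

theorem bern_add (p : ℝ) (S : Finset α) (f g : Finset α → ℝ) :
    bern p S (fun B => f B + g B) = bern p S f + bern p S g := by
  simp only [bern, mul_add, Finset.sum_add_distrib]

theorem bern_sub (p : ℝ) (S : Finset α) (f g : Finset α → ℝ) :
    bern p S (fun B => f B - g B) = bern p S f - bern p S g := by
  simp only [bern, mul_sub, Finset.sum_sub_distrib]

theorem bern_const_mul (p : ℝ) (S : Finset α) (c : ℝ) (f : Finset α → ℝ) :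
    bern p S (fun B => c * f B) = c * bern p S f := by
  simp only [bern, Finset.mul_sum]
  exact Finset.sum_congr rfl fun B _ => by ring

theorem bern_sum (p : ℝ) (S : Finset α) {ι : Type*} (s : Finset ι) (f : ι → Finset α → ℝ) :
    bern p S (fun B => ∑ i ∈ s, f i B) = ∑ i ∈ s, bern p S (f i) := by
  simp only [bern, Finset.mul_sum]
  exact Finset.sum_comm

theorem bern_mono {p : ℝ} (h0 : 0 ≤ p) (h1 : p ≤ 1) (S : Finset α) {f g : Finset α → ℝ}
    (h : ∀ B ⊆ S, f B ≤ g B) : bern p S f ≤ bern p S g := by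
  have : 0 ≤ 1 - p := by linarith
  exact Finset.sum_le_sum fun B hB =>
    mul_le_mul_of_nonneg_left (h B (Finset.mem_powerset.1 hB)) (by positivity)

theorem bern_congr (p : ℝ) (S : Finset α) {f g : Finset α → ℝ}
    (h : ∀ B ⊆ S, f B = g B) : bern p S f = bern p S g :=
  Finset.sum_congr rfl fun B hB => by rw [h B (Finset.mem_powerset.1 hB)]

theorem bern_nonneg {p : ℝ} (h0 : 0 ≤ p) (h1 : p ≤ 1) (S : Finset α) {f : Finset α → ℝ}
    (h : ∀ B ⊆ S, 0 ≤ f B) : 0 ≤ bern p S f := by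
  simpa [bern_const] using bern_mono h0 h1 S (f := fun _ => 0) h

theorem abs_bern_le {p : ℝ} (h0 : 0 ≤ p) (h1 : p ≤ 1) (S : Finset α) (f : Finset α → ℝ) :
    |bern p S f| ≤ bern p S (fun B => |f B|) := by
  have : 0 ≤ 1 - p := by linarith
  refine (Finset.abs_sum_le_sum_abs _ _).trans_eq (Finset.sum_congr rfl fun B _ => ?_)
  rw [abs_mul, abs_of_nonneg (by positivity)]

variable [DecidableEq α]

theorem bern_insert (p : ℝ) {S : Finset α} {a : α} (ha : a ∉ S) (f : Finset α → ℝ) :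
    bern p (insert a S) f = p * bern p S (fun B => f (insert a B)) + (1 - p) * bern p S f := by
  unfold bern
  rw [Finset.sum_powerset_insert ha, add_comm, Finset.mul_sum, Finset.mul_sum]
  congr 1
  · refine Finset.sum_congr rfl fun B hB => ?_
    have hB := Finset.mem_powerset.1 hB
    rw [Finset.card_insert_of_notMem ha, Finset.card_insert_of_notMem (fun h => ha (hB h)),
      Nat.add_sub_add_right]
    ring
  · refine Finset.sum_congr rfl fun B hB => ?_
    have hB := Finset.card_le_card (Finset.mem_powerset.1 hB)
    rw [Finset.card_insert_of_notMem ha, Nat.sub_add_comm hB]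
    ring

/-- Independence: if no element influences both `f` and `g`, then the expectation of the product is
the product of the expectations. -/
theorem bern_mul (p : ℝ) (S : Finset α) (f g : Finset α → ℝ)
    (h : ∀ a, (∀ B, f (insert a B) = f B) ∨ (∀ B, g (insert a B) = g B)) :
    bern p S (fun B => f B * g B) = bern p S f * bern p S g := by
  induction S using Finset.induction_on generalizing f g with
  | empty => simp [bern]
  | insert a S ha ih =>
    rw [bern_insert p ha, bern_insert p ha, bern_insert p ha, ih f g h]
    rcases h a with h' | h'
    · simp only [h']
      rw [ih f (fun B => g (insert a B)) fun b => ?_]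
      · ring
      · refine (h b).imp id fun hb B => ?_
        rw [Finset.insert_comm, hb]
    · simp only [h']
      rw [ih (fun B => f (insert a B)) g fun b => ?_]
      · ring
      · refine (h b).imp (fun hb B => ?_) id
        rw [Finset.insert_comm, hb]

/-- The indicator of `A ⊆ B`. -/
noncomputable def ind (A B : Finset α) : ℝ := if A ⊆ B then 1 else 0

theorem ind_nonneg (A B : Finset α) : 0 ≤ ind A B := by unfold ind; split_ifs <;> norm_num

theorem ind_le_one (A B : Finset α) : ind A B ≤ 1 := by unfold ind; split_ifs <;> norm_num

theorem ind_mul (A A' B : Finset α) : ind A B * ind A' B = ind (A ∪ A') B := by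
  unfold ind
  by_cases h : A ⊆ B <;> by_cases h' : A' ⊆ B <;> simp [h, h', Finset.union_subset_iff]

theorem ind_insert {A : Finset α} {a : α} (ha : a ∉ A) (B : Finset α) :
    ind A (insert a B) = ind A B := by
  unfold ind
  simp [Finset.subset_insert_iff_of_notMem ha]

theorem bern_ind (p : ℝ) {S A : Finset α} (hA : A ⊆ S) : bern p S (ind A) = p ^ A.card := by
  induction S using Finset.induction_on generalizing A with
  | empty =>
    obtain rfl := Finset.subset_empty.1 hA
    simp [bern, ind]
  | insert a S ha ih =>
    rw [bern_insert p ha]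
    by_cases h : a ∈ A
    · have h1 : bern p S (fun B => ind A (insert a B)) = p ^ (A.erase a).card := by
        rw [← ih (A := A.erase a) (by rwa [← Finset.subset_insert_iff])]
        exact bern_congr _ _ fun B _ => by simp only [ind, Finset.subset_insert_iff]
      have h2 : bern p S (ind A) = 0 := by
        rw [← bern_const p S 0]
        exact bern_congr _ _ fun B hB => if_neg fun hAB => ha (hB (hAB h))
      rw [h1, h2, ← Finset.card_erase_add_one h]
      ring
    · simp only [ind_insert h]
      rw [ih ((Finset.subset_insert_iff_of_notMem h).1 hA)]
      ring

/-- The centred indicator of `A ⊆ B`. -/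
noncomputable def cen (p : ℝ) (A B : Finset α) : ℝ := ind A B - p ^ A.card

theorem cen_insert (p : ℝ) {A : Finset α} {a : α} (ha : a ∉ A) (B : Finset α) :
    cen p A (insert a B) = cen p A B := by
  unfold cen
  rw [ind_insert ha]

theorem bern_cen (p : ℝ) {S A : Finset α} (hA : A ⊆ S) : bern p S (cen p A) = 0 := by
  unfold cen
  rw [bern_sub, bern_ind p hA, bern_const, sub_self]

theorem abs_cen_le {p : ℝ} (h0 : 0 ≤ p) (A B : Finset α) :
    |cen p A B| ≤ ind A B + p ^ A.card := by
  have := ind_nonneg A B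
  have : 0 ≤ p ^ A.card := by positivity
  unfold cen
  rw [abs_le]
  constructor <;> linarith

theorem abs_cen_le_one {p : ℝ} (h0 : 0 ≤ p) (h1 : p ≤ 1) (A B : Finset α) :
    |cen p A B| ≤ 1 := by
  have := ind_nonneg A B
  have := ind_le_one A B
  have : 0 ≤ p ^ A.card := by positivity
  have : p ^ A.card ≤ 1 := pow_le_one₀ h0 h1
  unfold cen
  rw [abs_le]
  constructor <;> linarith

/-- Each factor splits into two terms: the indicator enlarges U to U ∪ A l, while the constant p^|A
l| is at least as good because cardinality is subadditive under union. Hence a factor 2 per set. The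
extra set U is there to carry the induction. -/
theorem bern_ind_mul_prod_le {p : ℝ} (h0 : 0 ≤ p) (h1 : p ≤ 1) {S : Finset α} {κ : Type*}
    (T : Finset κ) (A : κ → Finset α) (hA : ∀ l, A l ⊆ S) {U : Finset α} (hU : U ⊆ S) :
    bern p S (fun B => ind U B * ∏ l ∈ T, (ind (A l) B + p ^ (A l).card)) ≤
      2 ^ T.card * p ^ (U ∪ T.biUnion A).card := by
  classical
  induction T using Finset.induction_on generalizing U with
  | empty => simp [bern_ind p hU]
  | insert l T hl ih =>
    have hrw : ∀ B, ind U B * ∏ i ∈ insert l T, (ind (A i) B + p ^ (A i).card) =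
        ind (U ∪ A l) B * ∏ i ∈ T, (ind (A i) B + p ^ (A i).card) +
        p ^ (A l).card * (ind U B * ∏ i ∈ T, (ind (A i) B + p ^ (A i).card)) := by
      intro B
      rw [Finset.prod_insert hl, ← ind_mul]
      ring
    simp only [hrw]
    rw [bern_add, bern_const_mul, Finset.card_insert_of_notMem hl, Finset.biUnion_insert]
    have e1 := ih (Finset.union_subset hU (hA l))
    have e2 := mul_le_mul_of_nonneg_left (ih hU) (show 0 ≤ p ^ (A l).card by positivity)
    have e3 : p ^ (A l).card * p ^ (U ∪ T.biUnion A).card ≤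
        p ^ (U ∪ (A l ∪ T.biUnion A)).card := by
      rw [← pow_add]
      refine pow_le_pow_of_le_one h0 h1 ?_
      rw [Finset.union_left_comm]
      exact Finset.card_union_le _ _
    rw [Finset.union_assoc] at e1
    have e4 : p ^ (A l).card * (2 ^ T.card * p ^ (U ∪ T.biUnion A).card) ≤
        2 ^ T.card * p ^ (U ∪ (A l ∪ T.biUnion A)).card := by
      rw [mul_left_comm]
      exact mul_le_mul_of_nonneg_left e3 (by positivity)
    rw [pow_succ]
    linarith

theorem bern_prod_le {p : ℝ} (h0 : 0 ≤ p) (h1 : p ≤ 1) {S : Finset α} {κ : Type*}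
    (T : Finset κ) (A : κ → Finset α) (hA : ∀ l, A l ⊆ S) :
    bern p S (fun B => ∏ l ∈ T, (ind (A l) B + p ^ (A l).card)) ≤
      2 ^ T.card * p ^ (T.biUnion A).card := by
  have := bern_ind_mul_prod_le h0 h1 T A hA (Finset.empty_subset S)
  simpa [ind] using this

theorem bern_abs_prod_cen_le {p : ℝ} (h0 : 0 ≤ p) (h1 : p ≤ 1) {S : Finset α} {κ : Type*}
    (T : Finset κ) (A : κ → Finset α) (hA : ∀ l, A l ⊆ S) :
    bern p S (fun B => |∏ l ∈ T, cen p (A l) B|) ≤ 2 ^ T.card * p ^ (T.biUnion A).card := by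
  refine (bern_mono h0 h1 S fun B _ => ?_).trans (bern_prod_le h0 h1 T A hA)
  rw [Finset.abs_prod]
  exact Finset.prod_le_prod (fun _ _ => abs_nonneg _) fun l _ => abs_cen_le h0 (A l) B

/-- The factor of an isolated set is independent of the product of the others and has mean zero. -/
theorem bern_prod_cen_eq_zero (p : ℝ) {S : Finset α} {κ : Type*} [Fintype κ]
    (A : κ → Finset α) (hA : ∀ l, A l ⊆ S) {l : κ} (hl : ∀ l' ≠ l, Disjoint (A l) (A l')) :
    bern p S (fun B => ∏ i, cen p (A i) B) = 0 := by
  classical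
  have : ∀ B, ∏ i, cen p (A i) B = cen p (A l) B * ∏ i ∈ Finset.univ.erase l, cen p (A i) B :=
    fun B => (Finset.mul_prod_erase _ _ (Finset.mem_univ l)).symm
  simp only [this]
  rw [bern_mul, bern_cen p (hA l), zero_mul]
  intro a
  by_cases ha : a ∈ A l
  · right
    intro B
    refine Finset.prod_congr rfl fun i hi => cen_insert p (fun h => ?_) B
    exact Finset.disjoint_left.1 (hl i (Finset.ne_of_mem_erase hi)) ha h
  · left
    exact cen_insert p ha

end RandomSubset

/-! ### Even central moments, through dominating sets. -/

/-- A finite relation without isolated vertices has a dominating set that contains at most half of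
the vertices. -/
theorem exists_dominating_card_le {κ : Type*} [Fintype κ] (r : κ → κ → Prop)
    (hsymm : ∀ a b, r a b → r b a) (h : ∀ a, ∃ b, b ≠ a ∧ r a b) :
    ∃ T : Finset κ, 2 * T.card ≤ Fintype.card κ ∧ ∀ a ∉ T, ∃ b ∈ T, r a b := by
  classical
  have hne : (Finset.univ.filter fun T : Finset κ => ∀ a ∉ T, ∃ b ∈ T, r a b).Nonempty :=
    ⟨Finset.univ, by simp⟩
  obtain ⟨T, hT, hmin⟩ := Finset.exists_min_image _ Finset.card hne
  simp only [Finset.mem_filter, Finset.mem_univ, true_and] at hT hmin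
  by_cases hc : 2 * T.card ≤ Fintype.card κ
  · exact ⟨T, hc, hT⟩
  -- T is a smallest dominating set. If it has more than half of the vertices, its complement is
  -- small enough and also dominates: were all neighbours of some a in T again in T, then T without
  -- a would still dominate.
  refine ⟨Tᶜ, ?_, fun a ha => ?_⟩
  · rw [Finset.card_compl]
    omega
  · have ha : a ∈ T := by simpa using ha
    by_contra! hcon
    have hb : ∀ b, r a b → b ∈ T := fun b hab => by
      by_contra hb
      exact hcon b (by simpa using hb) hab
    have := hmin (T.erase a) fun c hc => ?_
    · have := Finset.card_erase_lt_of_mem ha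
      omega
    · by_cases hca : c = a
      · subst hca
        obtain ⟨b, hbc, hr⟩ := h c
        exact ⟨b, Finset.mem_erase.2 ⟨hbc, hb b hr⟩, hr⟩
      · have hcT : c ∉ T := fun hcT => hc (Finset.mem_erase.2 ⟨hca, hcT⟩)
        obtain ⟨b, hbT, hr⟩ := hT c hcT
        refine ⟨b, Finset.mem_erase.2 ⟨?_, hbT⟩, hr⟩
        rintro rfl
        exact hcT (hb c (hsymm _ _ hr))

section Moments

variable {α ι : Type*} [DecidableEq α] [Fintype ι]

/-- For every set `U` of at most `L` elements, the expected number of sets `A i` that meet `U` and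
are contained in the random set, given that `U` is contained in it, is at most `D`. -/
def IntersectionBound (p : ℝ) (A : ι → Finset α) (L : ℕ) (D : ℝ) : Prop :=
  ∀ U : Finset α, U.card ≤ L →
    ∑ i, (if Disjoint (A i) U then 0 else p ^ (A i \ U).card) ≤ D

/-- The sets are revealed one at a time: if U is the union so far, the next set contributes ∑ w i *
p^|A i \ U| ≤ b. The lower bound U₀ ⊆ U lets the weights test whether a set meets a fixed U₀, as
`sum_dominated_le` needs; L leaves room for all unions that occur. -/
theorem sum_prod_mul_pow_card_le {p : ℝ} (h0 : 0 ≤ p) (A : ι → Finset α) {e L : ℕ}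
    (hA : ∀ i, (A i).card ≤ e) (w : ι → ℝ) (hw : ∀ i, 0 ≤ w i) {b : ℝ} (hb : 0 ≤ b)
    (U₀ : Finset α)
    (hB : ∀ U, U₀ ⊆ U → U.card ≤ L → ∑ i, w i * p ^ (A i \ U).card ≤ b)
    (κ : Type*) [Fintype κ] [DecidableEq κ] :
    ∀ U, U₀ ⊆ U → U.card + e * Fintype.card κ ≤ L →
      ∑ f : κ → ι, (∏ l, w (f l)) * p ^ (U ∪ Finset.univ.biUnion fun l => A (f l)).card ≤
        p ^ U.card * b ^ Fintype.card κ := by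
  classical
  refine Fintype.induction_empty_option
    (P := fun κ _ => ∀ U, U₀ ⊆ U → U.card + e * Fintype.card κ ≤ L →
      ∑ f : κ → ι, (∏ l, w (f l)) * p ^ (U ∪ Finset.univ.biUnion fun l => A (f l)).card ≤
        p ^ U.card * b ^ Fintype.card κ) ?_ ?_ ?_ κ |> fun h => by convert h
  · intro κ κ' _ E ih U hU hL
    let _ := Fintype.ofEquiv κ' E.symm
    have hc := Fintype.card_congr E
    have := ih U hU (by convert hL)
    rw [← hc]
    refine le_trans (le_of_eq ?_) (by convert this)
    refine (Fintype.sum_equiv (Equiv.arrowCongr E (Equiv.refl ι)) _ _ fun f => ?_).symm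
    congr 1
    · exact Fintype.prod_equiv E _ _ fun l => by simp
    · congr 3
      ext x
      simp only [Finset.mem_biUnion, Finset.mem_univ, true_and]
      constructor
      · rintro ⟨l, hl⟩
        exact ⟨E l, by simpa using hl⟩
      · rintro ⟨l, hl⟩
        exact ⟨E.symm l, by simpa using hl⟩
  · intro U hU hL
    simp
  · intro κ _ ih U hU hL
    rw [Fintype.card_option] at hL ⊢
    rw [Finset.sum_equiv (t := Finset.univ)
      (Equiv.piOptionEquivProd (β := fun _ : Option κ => ι)) (fun _ => by simp)
      (g := fun x => (∏ l, w ((Equiv.piOptionEquivProd (β := fun _ : Option κ => ι)).symm x l)) *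
        p ^ (U ∪ Finset.univ.biUnion fun l =>
          A ((Equiv.piOptionEquivProd (β := fun _ : Option κ => ι)).symm x l)).card)
      (fun f _ => by rw [Equiv.symm_apply_apply]), Fintype.sum_prod_type]
    have hstep : ∀ i, ∑ g : κ → ι,
        (∏ l, w ((Equiv.piOptionEquivProd (β := fun _ : Option κ => ι)).symm (i, g) l)) *
          p ^ (U ∪ Finset.univ.biUnion fun l =>
            A ((Equiv.piOptionEquivProd (β := fun _ : Option κ => ι)).symm (i, g) l)).card ≤
        p ^ U.card * b ^ Fintype.card κ * (w i * p ^ (A i \ U).card) := by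
      intro i
      have hcard : (U ∪ A i).card = U.card + (A i \ U).card := by
        rw [← Finset.union_sdiff_self_eq_union, Finset.card_union_of_disjoint]
        exact Finset.disjoint_sdiff
      have hle : (U ∪ A i).card + e * Fintype.card κ ≤ L := by
        have := Finset.card_union_le U (A i)
        have := hA i
        rw [mul_add] at hL
        omega
      have := mul_le_mul_of_nonneg_left (ih (U ∪ A i) (hU.trans Finset.subset_union_left) hle)
        (hw i)
      rw [Finset.mul_sum] at this
      refine le_trans (le_of_eq ?_) (this.trans_eq ?_)
      · refine Finset.sum_congr rfl fun g _ => ?_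
        rw [Fintype.prod_option, mul_assoc]
        congr 4
        ext x
        simp only [Finset.mem_union, Finset.mem_biUnion, Finset.mem_univ, true_and, Option.exists,
          or_assoc]
        rfl
      · rw [hcard, pow_add]
        ring
    refine (Finset.sum_le_sum fun i _ => hstep i).trans ?_
    rw [← Finset.mul_sum, pow_succ, ← mul_assoc]
    have hUL : U.card ≤ L := by omega
    have := hB U hU hUL
    gcongr

/-- Sets disjoint from U keep their unconditional weight; D pays for those that meet it. -/
theorem sum_pow_card_sdiff_le {p : ℝ} (h0 : 0 ≤ p) {A : ι → Finset α} {L : ℕ}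
    {D : ℝ} (hD : IntersectionBound p A L D) {U : Finset α} (hU : U.card ≤ L) :
    ∑ i, p ^ (A i \ U).card ≤ ∑ i, p ^ (A i).card + D := by
  refine le_trans ?_ (add_le_add_right (hD U hU) _)
  rw [← Finset.sum_add_distrib]
  refine Finset.sum_le_sum fun i _ => ?_
  split_ifs with h
  · rw [Finset.sdiff_eq_self_of_disjoint h, add_zero]
  · have : 0 ≤ p ^ (A i).card := by positivity
    linarith

theorem IntersectionBound.nonneg {p : ℝ} (h0 : 0 ≤ p) {A : ι → Finset α} {L : ℕ}
    {D : ℝ} (hD : IntersectionBound p A L D) : 0 ≤ D := by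
  refine le_trans (Finset.sum_nonneg fun i _ => ?_) (hD ∅ (by simp))
  split_ifs <;> positivity

/-- The sets indexed by T are revealed first, without restriction, at a cost of M + D each. Every
other set has to meet their union and so costs only D. -/
theorem sum_dominated_le {p : ℝ} (h0 : 0 ≤ p) {A : ι → Finset α} {e L : ℕ}
    (hA : ∀ i, (A i).card ≤ e) {D : ℝ} (hD : IntersectionBound p A L D)
    {κ : Type*} [Fintype κ] [DecidableEq κ] (hL : e * Fintype.card κ ≤ L) (T : Finset κ) :
    ∑ f : κ → ι, (∏ l ∈ Tᶜ, if Disjoint (A (f l)) (T.biUnion fun l' => A (f l')) then (0 : ℝ)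
        else 1) * p ^ (Finset.univ.biUnion fun l => A (f l)).card ≤
      (∑ i, p ^ (A i).card + D) ^ T.card * D ^ (Fintype.card κ - T.card) := by
  have hD0 := hD.nonneg h0
  have hM0 : 0 ≤ ∑ i, p ^ (A i).card := Finset.sum_nonneg fun _ _ => by positivity
  have hT : Fintype.card {l // l ∈ T} = T.card := Fintype.card_coe T
  have hTc : Fintype.card {l // l ∉ T} = Fintype.card κ - T.card := by
    rw [Fintype.card_subtype_compl, hT]
  have hTle : T.card ≤ Fintype.card κ := T.card_le_univ
  let E := Equiv.piEquivPiSubtypeProd (fun l => l ∈ T) fun _ : κ => ι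
  rw [← E.symm.sum_comp, Fintype.sum_prod_type]
  have hin : ∀ (q : {l // l ∈ T} → ι) (r : {l // l ∉ T} → ι) (l : κ) (hl : l ∈ T),
      E.symm (q, r) l = q ⟨l, hl⟩ := fun q r l hl => by
    simp [E, Equiv.piEquivPiSubtypeProd, hl]
  have hout : ∀ (q : {l // l ∈ T} → ι) (r : {l // l ∉ T} → ι) (l : κ) (hl : l ∉ T),
      E.symm (q, r) l = r ⟨l, hl⟩ := fun q r l hl => by
    simp [E, Equiv.piEquivPiSubtypeProd, hl]
  have hinner : ∀ q : {l // l ∈ T} → ι, ∑ r : {l // l ∉ T} → ι,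
      (∏ l ∈ Tᶜ, if Disjoint (A (E.symm (q, r) l)) (T.biUnion fun l' => A (E.symm (q, r) l'))
        then (0 : ℝ) else 1) * p ^ (Finset.univ.biUnion fun l => A (E.symm (q, r) l)).card ≤
      (∏ _l : {l // l ∈ T}, (1 : ℝ)) * p ^ (∅ ∪ Finset.univ.biUnion fun l => A (q l)).card *
        D ^ (Fintype.card κ - T.card) := by
    intro q
    set U := Finset.univ.biUnion fun l => A (q l) with hU
    have hUT : ∀ r, (T.biUnion fun l' => A (E.symm (q, r) l')) = U := by
      intro r
      ext x
      simp only [hU, Finset.mem_biUnion, Finset.mem_univ, true_and, Subtype.exists]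
      constructor
      · rintro ⟨l, hl, hx⟩
        exact ⟨l, hl, by rwa [hin q r l hl] at hx⟩
      · rintro ⟨l, hl, hx⟩
        exact ⟨l, hl, by rwa [hin q r l hl]⟩
    have hUr : ∀ r, (Finset.univ.biUnion fun l => A (E.symm (q, r) l)) =
        U ∪ Finset.univ.biUnion fun l => A (r l) := by
      intro r
      ext x
      simp only [hU, Finset.mem_biUnion, Finset.mem_univ, true_and, Subtype.exists,
        Finset.mem_union]
      constructor
      · rintro ⟨l, hx⟩
        by_cases hl : l ∈ T
        · exact Or.inl ⟨l, hl, by rwa [hin q r l hl] at hx⟩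
        · exact Or.inr ⟨l, hl, by rwa [hout q r l hl] at hx⟩
      · rintro (⟨l, hl, hx⟩ | ⟨l, hl, hx⟩)
        · exact ⟨l, by rwa [hin q r l hl]⟩
        · exact ⟨l, by rwa [hout q r l hl]⟩
    have hprod : ∀ r, (∏ l ∈ Tᶜ, if Disjoint (A (E.symm (q, r) l)) U then (0 : ℝ) else 1) =
        ∏ l, if Disjoint (A (r l)) U then (0 : ℝ) else 1 := by
      intro r
      rw [Finset.prod_subtype (p := fun l => l ∉ T) _ (fun l => by simp)]
      exact Finset.prod_congr rfl fun l _ => by rw [hout q r l l.2]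
    simp only [hUT, hUr, hprod]
    have hUc : U.card ≤ e * T.card := by
      rw [← hT, mul_comm]
      exact Finset.card_biUnion_le_card_mul _ _ _ fun l _ => hA _
    have := sum_prod_mul_pow_card_le h0 A hA (fun i => if Disjoint (A i) U then (0 : ℝ) else 1)
      (fun i => by split_ifs <;> norm_num) hD0 U (L := L) (fun U' hUU hUL => ?_) {l // l ∉ T} U
      subset_rfl (by
        rw [hTc]
        calc _ ≤ e * T.card + e * (Fintype.card κ - T.card) := by gcongr
          _ = e * Fintype.card κ := by rw [← mul_add, Nat.add_sub_cancel' hTle]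
          _ ≤ L := hL)
    · rw [hTc] at this
      simpa using this
    · refine le_trans (Finset.sum_le_sum fun i _ => ?_) (hD U' hUL)
      by_cases h : Disjoint (A i) U
      · simp only [h, if_true, zero_mul]
        split_ifs <;> positivity
      · rw [if_neg h, if_neg fun h' => h (h'.mono_right hUU), one_mul]
  refine (Finset.sum_le_sum fun q _ => hinner q).trans ?_
  rw [← Finset.sum_mul]
  have := sum_prod_mul_pow_card_le h0 A hA (fun _ => 1) (fun _ => zero_le_one)
    (add_nonneg hM0 hD0) ∅ (L := L)
    (fun U _ hU => by simpa using sum_pow_card_sdiff_le h0 hD hU) {l // l ∈ T} ∅ subset_rfl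
    (by
      rw [hT]
      calc _ ≤ e * Fintype.card κ := by
            rw [Finset.card_empty, zero_add]
            gcongr
        _ ≤ L := hL)
  rw [hT, Finset.card_empty, pow_zero, one_mul] at this
  gcongr

/-- If the expectation can be nonzero, "A l meets A l'" has no isolated vertex, so some T with at
most half of the indices dominates and its summand alone is a bound. Summing over all T removes the
dependence of T on the sets, so that tuples can later be summed with T fixed. -/
theorem bern_prod_cen_le_sum {p : ℝ} (h0 : 0 ≤ p) (h1 : p ≤ 1) {S : Finset α}
    {κ : Type*} [Fintype κ] [DecidableEq κ] (A : κ → Finset α) (hA : ∀ l, A l ⊆ S) :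
    bern p S (fun B => ∏ l, cen p (A l) B) ≤
      ∑ T ∈ Finset.univ.filter (fun T : Finset κ => 2 * T.card ≤ Fintype.card κ),
        2 ^ Fintype.card κ * ((∏ l ∈ Tᶜ, if Disjoint (A l) (T.biUnion A) then (0 : ℝ) else 1) *
          p ^ (Finset.univ.biUnion A).card) := by
  have hnn : ∀ T : Finset κ,
      0 ≤ (2 : ℝ) ^ Fintype.card κ *
        ((∏ l ∈ Tᶜ, if Disjoint (A l) (T.biUnion A) then (0 : ℝ) else 1) *
          p ^ (Finset.univ.biUnion A).card) := fun T => by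
    have : (0 : ℝ) ≤ ∏ l ∈ Tᶜ, if Disjoint (A l) (T.biUnion A) then (0 : ℝ) else 1 :=
      Finset.prod_nonneg fun l _ => by split_ifs <;> norm_num
    positivity
  by_cases h : ∀ l, ∃ l', l' ≠ l ∧ ¬ Disjoint (A l) (A l')
  · obtain ⟨T, hT, hdom⟩ := exists_dominating_card_le (fun l l' => ¬ Disjoint (A l) (A l'))
      (fun a b hab hba => hab hba.symm) h
    refine le_trans ?_ (Finset.single_le_sum (f := fun T : Finset κ =>
      (2 : ℝ) ^ Fintype.card κ *
        ((∏ l ∈ Tᶜ, if Disjoint (A l) (T.biUnion A) then (0 : ℝ) else 1) *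
          p ^ (Finset.univ.biUnion A).card)) (fun T _ => hnn T) (a := T) (by simpa using hT))
    have hone : (∏ l ∈ Tᶜ, if Disjoint (A l) (T.biUnion A) then (0 : ℝ) else 1) = 1 := by
      refine Finset.prod_eq_one fun l hl => if_neg fun hdis => ?_
      obtain ⟨l', hl', hr⟩ := hdom l (by simpa using hl)
      exact hr (hdis.mono_right (Finset.subset_biUnion_of_mem A hl'))
    rw [hone, one_mul]
    exact (le_abs_self _).trans ((abs_bern_le h0 h1 S _).trans
      (bern_abs_prod_cen_le h0 h1 Finset.univ A hA))
  · push Not at h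
    obtain ⟨l, hl⟩ := h
    rw [bern_prod_cen_eq_zero p A hA hl]
    exact Finset.sum_nonneg fun T _ => hnn T

/-- Bound for the even central moments of the number of sets `A i` in a random set. -/
theorem bern_sum_cen_pow_le {p : ℝ} (h0 : 0 ≤ p) (h1 : p ≤ 1) {S : Finset α}
    {A : ι → Finset α} (hAS : ∀ i, A i ⊆ S) {e L : ℕ} (hA : ∀ i, (A i).card ≤ e) {D : ℝ}
    (hD : IntersectionBound p A L D) (m : ℕ) (hL : e * (2 * m) ≤ L) :
    bern p S (fun B => (∑ i, cen p (A i) B) ^ (2 * m)) ≤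
      16 ^ m * ((∑ i, p ^ (A i).card + D) * D) ^ m := by
  have hD0 := hD.nonneg h0
  have hM0 : 0 ≤ ∑ i, p ^ (A i).card := Finset.sum_nonneg fun _ _ => by positivity
  have hrw : ∀ B, (∑ i, cen p (A i) B) ^ (2 * m) =
      ∑ f : Fin (2 * m) → ι, ∏ l, cen p (A (f l)) B := fun B => by
    rw [Finset.sum_pow']
    simp [Fintype.piFinset_univ]
  simp only [hrw]
  rw [bern_sum]
  refine (Finset.sum_le_sum fun f _ =>
    bern_prod_cen_le_sum h0 h1 (fun l => A (f l)) fun l => hAS _).trans ?_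
  rw [Finset.sum_comm]
  -- One factor 4^m is the 2^(2m) from the absolute values of the centred indicators, the other
  -- bounds the number of sets T.
  refine (Finset.sum_le_card_nsmul _ _ (4 ^ m * ((∑ i, p ^ (A i).card + D) * D) ^ m)
    fun T hT => ?_).trans ?_
  · rw [← Finset.mul_sum]
    have hT : T.card ≤ m := by
      have := (Finset.mem_filter.1 hT).2
      rw [Fintype.card_fin] at this
      omega
    have h4 : (2 : ℝ) ^ Fintype.card (Fin (2 * m)) = 4 ^ m := by
      rw [Fintype.card_fin, pow_mul]
      norm_num
    rw [h4]
    refine mul_le_mul_of_nonneg_left ?_ (by positivity)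
    refine (sum_dominated_le h0 hA hD (by simpa using hL) T).trans ?_
    -- There are m − |T| factors D beyond the m wanted ones; each is at most M + D.
    rw [Fintype.card_fin, show 2 * m - T.card = m + (m - T.card) by omega, pow_add, mul_pow,
      mul_left_comm, mul_comm (D ^ m)]
    refine mul_le_mul_of_nonneg_right ?_ (by positivity)
    calc _ ≤ (∑ i, p ^ (A i).card + D) ^ T.card * (∑ i, p ^ (A i).card + D) ^ (m - T.card) := by
          gcongr
          linarith
      _ = _ := by rw [← pow_add, Nat.add_sub_cancel' hT]
  · rw [nsmul_eq_mul, ← mul_assoc]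
    refine mul_le_mul_of_nonneg_right ?_ (by positivity)
    calc _ ≤ ((Fintype.card (Finset (Fin (2 * m))) : ℕ) : ℝ) * 4 ^ m := by
          gcongr
          exact Finset.card_le_univ _
      _ = 16 ^ m := by
          rw [Fintype.card_finset, Fintype.card_fin, pow_mul]
          push_cast
          rw [← mul_pow]
          norm_num

end Moments

/-! ### Stein's method and the small ball estimate. -/

section SmallBall

theorem abs_two_div_one_add_sq_sub_le (u v : ℝ) :
    |2 / (1 + u ^ 2) - 2 / (1 + v ^ 2)| ≤ 2 * |u - v| := by
  have hu : 0 < 1 + u ^ 2 := by positivity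
  have hv : 0 < 1 + v ^ 2 := by positivity
  have h : 2 / (1 + u ^ 2) - 2 / (1 + v ^ 2) =
      -(2 * (u - v) * ((u + v) / ((1 + u ^ 2) * (1 + v ^ 2)))) := by
    field_simp
    ring
  rw [h, abs_neg, abs_mul, abs_mul, abs_two]
  refine mul_le_of_le_one_right (by positivity) ?_
  rw [abs_div, abs_of_pos (mul_pos hu hv), div_le_one (mul_pos hu hv), abs_le]
  constructor <;> nlinarith [sq_nonneg (u + 1), sq_nonneg (v + 1), sq_nonneg (u - 1),
    sq_nonneg (v - 1), mul_nonneg (sq_nonneg u) (sq_nonneg v)]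

/-- The test function for Stein's identity: it is O(h), its derivative is nonnegative and at least 1
on [-h, h], and that derivative is Lipschitz with constant 2/h. -/
theorem hasDerivAt_two_mul_arctan {h : ℝ} (hh : 0 < h) (x : ℝ) :
    HasDerivAt (fun x => 2 * h * Real.arctan (x / h)) (2 / (1 + (x / h) ^ 2)) x := by
  have := (((hasDerivAt_id x).div_const h).arctan).const_mul (2 * h)
  refine this.congr_deriv ?_
  simp only [id]
  field_simp

theorem abs_two_div_one_add_div_sq_sub_le {h : ℝ} (hh : 0 < h) (x y : ℝ) :
    |2 / (1 + (x / h) ^ 2) - 2 / (1 + (y / h) ^ 2)| ≤ 2 / h * |x - y| := by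
  refine (abs_two_div_one_add_sq_sub_le _ _).trans_eq ?_
  rw [← sub_div, abs_div, abs_of_pos hh]
  ring

/-- Mean value inequality between x and x − y for the function minus its linear part at x, whose
derivative there is at most (2/h)|y|. -/
theorem abs_arctan_taylor_le {h : ℝ} (hh : 0 < h) (x y : ℝ) :
    |2 * h * Real.arctan (x / h) - 2 * h * Real.arctan ((x - y) / h) -
      y * (2 / (1 + (x / h) ^ 2))| ≤ 2 / h * y ^ 2 := by
  have key := (convex_uIcc x (x - y)).norm_image_sub_le_of_norm_hasDerivWithin_le
    (f := fun z => 2 * h * Real.arctan (z / h) - z * (2 / (1 + (x / h) ^ 2)))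
    (f' := fun z => 2 / (1 + (z / h) ^ 2) - 1 * (2 / (1 + (x / h) ^ 2)))
    (C := 2 / h * |y|)
    (fun z _ => ((hasDerivAt_two_mul_arctan hh z).sub
      ((hasDerivAt_id z).mul_const _)).hasDerivWithinAt)
    (fun z hz => by
      rw [one_mul, Real.norm_eq_abs]
      refine (abs_two_div_one_add_div_sq_sub_le hh z x).trans ?_
      refine mul_le_mul_of_nonneg_left ?_ (by positivity)
      have := Set.abs_sub_left_of_mem_uIcc hz
      simpa using this)
    Set.right_mem_uIcc Set.left_mem_uIcc
  simp only [Real.norm_eq_abs, sub_sub_cancel] at key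
  rw [mul_assoc (2 / h), ← abs_mul, abs_mul_self, ← sq] at key
  convert key using 2
  ring

variable {α ι : Type*} [DecidableEq α] [Fintype ι]

/-- With q = p^|A| the mean is 2q(1 − q), and 1 − q ≤ |A|(1 − p) by Bernoulli's inequality. -/
theorem bern_abs_cen_le {p : ℝ} (h0 : 0 ≤ p) (h1 : p ≤ 1) {S A : Finset α} (hA : A ⊆ S) {e : ℕ}
    (he : A.card ≤ e) : bern p S (fun B => |cen p A B|) ≤ 2 * e * (1 - p) := by
  set q := p ^ A.card with hq
  have hq0 : 0 ≤ q := by positivity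
  have hq1 : q ≤ 1 := pow_le_one₀ h0 h1
  have hrw : ∀ B, |cen p A B| = (1 - 2 * q) * ind A B + q := fun B => by
    unfold cen ind
    rw [← hq]
    split_ifs
    · rw [abs_of_nonneg (by linarith)]
      ring
    · rw [abs_of_nonpos (by linarith)]
      ring
  simp only [hrw]
  rw [bern_add, bern_const_mul, bern_ind p hA, bern_const, ← hq]
  have hb := one_add_mul_le_pow (a := p - 1) (by linarith) A.card
  rw [add_sub_cancel, ← hq] at hb
  have hc : (A.card : ℝ) ≤ e := by exact_mod_cast he
  nlinarith [mul_nonneg hq0 (sub_nonneg.2 hq1), mul_nonneg (sub_nonneg.2 hc) (sub_nonneg.2 h1)]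

/-- Combines a bound that is good for small p with one that is good for p near 1. For p ≤ 1/2 the
factor 1 − p is at least 1/2; for p ≥ 1/2 the power p^N is at least 8^(-e). The factor 1 − p keeps
the third-order terms comparable with the variance as p → 1. -/
theorem le_mul_one_sub_mul_pow {p : ℝ} (h0 : 0 ≤ p) (h1 : p ≤ 1) {e N : ℕ} (hN : N ≤ 3 * e)
    {x : ℝ} (hx : x ≤ 8 * p ^ N) (hx' : x ≤ 2 * e * (1 - p)) :
    x ≤ (16 + 2 * e * 8 ^ e) * (1 - p) * p ^ N := by
  have hP : 0 ≤ p ^ N := by positivity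
  have hp : 0 ≤ 1 - p := by linarith
  rcases le_total p (1 / 2) with h | h
  · have : 0 ≤ 2 * e * 8 ^ e * (1 - p) * p ^ N := by positivity
    nlinarith
  · have h2 : (1 : ℝ) ≤ 8 ^ e * p ^ N := by
      calc (1 : ℝ) = 8 ^ e * (1 / 2) ^ (3 * e) := by
            rw [pow_mul, ← mul_pow]
            norm_num
        _ ≤ 8 ^ e * p ^ (3 * e) := by gcongr
        _ ≤ 8 ^ e * p ^ N := by
            gcongr ?_ * ?_
            exact pow_le_pow_of_le_one h0 h1 hN
    have h3 : 2 * e * (1 - p) * 1 ≤ 2 * e * (1 - p) * (8 ^ e * p ^ N) := by gcongr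
    have : 0 ≤ 16 * (1 - p) * p ^ N := by positivity
    nlinarith

theorem bern_abs_cen_mul_le {p : ℝ} (h0 : 0 ≤ p) (h1 : p ≤ 1) {S A A' : Finset α} (hA : A ⊆ S)
    (hA' : A' ⊆ S) : bern p S (fun B => |cen p A B * cen p A' B|) ≤ 4 * p ^ (A ∪ A').card := by
  have := bern_abs_prod_cen_le h0 h1 (S := S) Finset.univ ![A, A']
    (fun l => by fin_cases l <;> assumption)
  have hU : Finset.univ.biUnion ![A, A'] = A ∪ A' := by
    ext x
    simp [Fin.exists_fin_two]
  rw [hU] at this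
  norm_num [Fin.prod_univ_two] at this ⊢
  exact this

theorem bern_abs_cen_mul_mul_le {p : ℝ} (h0 : 0 ≤ p) (h1 : p ≤ 1) {S A A' A'' : Finset α}
    (hA : A ⊆ S) (hA' : A' ⊆ S) (hA'' : A'' ⊆ S) {e : ℕ} (he : A.card ≤ e) (he' : A'.card ≤ e)
    (he'' : A''.card ≤ e) :
    bern p S (fun B => |cen p A B * cen p A' B * cen p A'' B|) ≤
      (16 + 2 * e * 8 ^ e) * (1 - p) * p ^ (A ∪ A' ∪ A'').card := by
  refine le_mul_one_sub_mul_pow h0 h1 ?_ ?_ ?_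
  · have := Finset.card_union_le (A ∪ A') A''
    have := Finset.card_union_le A A'
    omega
  · have := bern_abs_prod_cen_le h0 h1 (S := S) Finset.univ ![A, A', A'']
      (fun l => by fin_cases l <;> assumption)
    have hU : Finset.univ.biUnion ![A, A', A''] = A ∪ A' ∪ A'' := by
      ext x
      simp [Fin.exists_fin_succ]
    rw [hU] at this
    norm_num [Fin.prod_univ_three] at this ⊢
    exact this
  · refine (bern_mono h0 h1 S fun B _ => ?_).trans (bern_abs_cen_le h0 h1 hA he)
    rw [abs_mul, abs_mul, mul_assoc]
    exact mul_le_of_le_one_right (abs_nonneg _)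
      (mul_le_one₀ (abs_cen_le_one h0 h1 _ _) (abs_nonneg _) (abs_cen_le_one h0 h1 _ _))

theorem bern_abs_cen_mul_mul_bern_le {p : ℝ} (h0 : 0 ≤ p) (h1 : p ≤ 1) {S A A' A'' : Finset α}
    (hA : A ⊆ S) (hA' : A' ⊆ S) (hA'' : A'' ⊆ S) {e : ℕ} (he : A.card ≤ e) (he' : A'.card ≤ e)
    (he'' : A''.card ≤ e) :
    bern p S (fun B => |cen p A B * cen p A' B|) * bern p S (fun B => |cen p A'' B|) ≤
      (16 + 2 * e * 8 ^ e) * (1 - p) * p ^ (A ∪ A' ∪ A'').card := by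
  have hnn : 0 ≤ bern p S (fun B => |cen p A'' B|) := bern_nonneg h0 h1 S fun _ _ => abs_nonneg _
  refine le_mul_one_sub_mul_pow h0 h1 ?_ ?_ ?_
  · have := Finset.card_union_le (A ∪ A') A''
    have := Finset.card_union_le A A'
    omega
  · have h2 : bern p S (fun B => |cen p A'' B|) ≤ 2 * p ^ A''.card := by
      refine (bern_mono h0 h1 S fun B _ => abs_cen_le h0 A'' B).trans_eq ?_
      rw [bern_add, bern_const, bern_ind p hA'']
      ring
    calc _ ≤ (4 * p ^ (A ∪ A').card) * (2 * p ^ A''.card) :=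
          mul_le_mul (bern_abs_cen_mul_le h0 h1 hA hA') h2 hnn (by positivity)
      _ = 8 * p ^ ((A ∪ A').card + A''.card) := by rw [pow_add]; ring
      _ ≤ _ := by
          refine mul_le_mul_of_nonneg_left ?_ (by norm_num)
          exact pow_le_pow_of_le_one h0 h1 (Finset.card_union_le _ _)
  · have h2 : bern p S (fun B => |cen p A'' B|) ≤ 1 := by
      rw [← bern_const p S 1]
      exact bern_mono h0 h1 S fun B _ => abs_cen_le_one h0 h1 _ _
    refine (mul_le_of_le_one_right (bern_nonneg h0 h1 S fun _ _ => abs_nonneg _) h2).trans ?_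
    refine (bern_mono h0 h1 S fun B _ => ?_).trans (bern_abs_cen_le h0 h1 hA he)
    rw [abs_mul]
    exact mul_le_of_le_one_right (abs_nonneg _) (abs_cen_le_one h0 h1 _ _)

/-- `1` if `A` and `U` meet, and `0` otherwise. -/
noncomputable def meet (A U : Finset α) : ℝ := if Disjoint A U then 0 else 1

theorem meet_nonneg (A U : Finset α) : 0 ≤ meet A U := by unfold meet; split_ifs <;> norm_num

theorem meet_mono (A : Finset α) {U U' : Finset α} (h : U ⊆ U') : meet A U ≤ meet A U' := by
  unfold meet
  split_ifs with h1 h2 h2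
  · exact le_rfl
  · norm_num
  · exact absurd (h2.mono_right h) h1
  · exact le_rfl

theorem sum_meet_mul_pow_card_union_le {p : ℝ} (h0 : 0 ≤ p) {A : ι → Finset α} {L : ℕ} {D : ℝ}
    (hD : IntersectionBound p A L D) {U : Finset α} (hU : U.card ≤ L) :
    ∑ i, meet (A i) U * p ^ (U ∪ A i).card ≤ p ^ U.card * D := by
  refine le_trans (le_of_eq ?_) (mul_le_mul_of_nonneg_left (hD U hU) (by positivity))
  rw [Finset.mul_sum]
  refine Finset.sum_congr rfl fun i _ => ?_
  unfold meet
  split_ifs with h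
  · simp
  · rw [one_mul, ← pow_add, ← Finset.union_sdiff_self_eq_union,
      Finset.card_union_of_disjoint Finset.disjoint_sdiff]

/-- Reveal the third set, then the second, then the first in the sum from inside out: given A i and
A j the sets A k cost D, given A i the sets A j cost D, and the A i add up to M. -/
theorem sum_sum_sum_meet_le {p : ℝ} (h0 : 0 ≤ p) {A : ι → Finset α} {e L : ℕ}
    (hA : ∀ i, (A i).card ≤ e) (hL : 2 * e ≤ L) {D : ℝ} (hD : IntersectionBound p A L D) :
    ∑ i, ∑ j, ∑ k, meet (A j) (A i) *
      (meet (A k) (A i ∪ A j) * p ^ (A i ∪ A j ∪ A k).card) ≤ (∑ i, p ^ (A i).card) * D ^ 2 := by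
  rw [Finset.sum_mul]
  refine Finset.sum_le_sum fun i _ => ?_
  have hD0 := hD.nonneg h0
  calc _ ≤ ∑ j, meet (A j) (A i) * (p ^ (A i ∪ A j).card * D) := by
        refine Finset.sum_le_sum fun j _ => ?_
        rw [← Finset.mul_sum]
        refine mul_le_mul_of_nonneg_left (sum_meet_mul_pow_card_union_le h0 hD ?_)
          (meet_nonneg _ _)
        have := Finset.card_union_le (A i) (A j)
        have := hA i
        have := hA j
        omega
    _ = (∑ j, meet (A j) (A i) * p ^ (A i ∪ A j).card) * D := by
        rw [Finset.sum_mul]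
        exact Finset.sum_congr rfl fun j _ => by ring
    _ ≤ p ^ (A i).card * D * D := by
        refine mul_le_mul_of_nonneg_right (sum_meet_mul_pow_card_union_le h0 hD ?_) hD0
        have := hA i
        omega
    _ = _ := by ring

theorem sum_cen_insert (p : ℝ) (A : ι → Finset α) (c : ι → ℝ) {a : α}
    (hc : ∀ i, a ∈ A i → c i = 0) (B : Finset α) :
    ∑ i, c i * cen p (A i) (insert a B) = ∑ i, c i * cen p (A i) B := by
  refine Finset.sum_congr rfl fun i _ => ?_
  by_cases h : a ∈ A i
  · rw [hc i h, zero_mul, zero_mul]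
  · rw [cen_insert p h]

theorem sum_cen_sub_sum_meet (p : ℝ) (A : ι → Finset α) (U B : Finset α) :
    ∑ i, cen p (A i) B - ∑ i, meet (A i) U * cen p (A i) B =
      ∑ i, (1 - meet (A i) U) * cen p (A i) B := by
  rw [← Finset.sum_sub_distrib]
  exact Finset.sum_congr rfl fun i _ => by ring

/-- Removing from the sum all terms whose sets meet U leaves a sum that does not see U, hence is
independent of g. -/
theorem bern_mul_comp_sum_eq (p : ℝ) (S : Finset α) (A : ι → Finset α) (U : Finset α)
    (g : Finset α → ℝ) (hg : ∀ a ∉ U, ∀ B, g (insert a B) = g B) (f : ℝ → ℝ) :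
    bern p S (fun B => g B * f (∑ i, cen p (A i) B - ∑ i, meet (A i) U * cen p (A i) B)) =
      bern p S g *
        bern p S (fun B => f (∑ i, cen p (A i) B - ∑ i, meet (A i) U * cen p (A i) B)) := by
  simp only [sum_cen_sub_sum_meet]
  refine bern_mul p S g _ fun a => ?_
  by_cases ha : a ∈ U
  · right
    intro B
    rw [sum_cen_insert p A _ fun i hi => ?_]
    rw [meet, if_neg, sub_self]
    exact fun h => Finset.disjoint_left.1 h hi ha
  · exact Or.inl (hg a ha)

theorem bern_sq_sum_cen (p : ℝ) {S : Finset α} {A : ι → Finset α} (hAS : ∀ i, A i ⊆ S) :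
    bern p S (fun B => (∑ i, cen p (A i) B) ^ 2) =
      ∑ i, ∑ j, meet (A j) (A i) * bern p S (fun B => cen p (A i) B * cen p (A j) B) := by
  simp only [sq, Finset.sum_mul_sum]
  rw [bern_sum]
  refine Finset.sum_congr rfl fun i _ => ?_
  rw [bern_sum]
  refine Finset.sum_congr rfl fun j _ => ?_
  unfold meet
  split_ifs with h
  · rw [zero_mul, bern_mul, bern_cen p (hAS i), zero_mul]
    intro a
    by_cases ha : a ∈ A i
    · exact Or.inr (cen_insert p (Finset.disjoint_right.1 h ha))
    · exact Or.inl (cen_insert p ha)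
  · rw [one_mul]

theorem bern_cen_mul_cen (p : ℝ) {S A A' : Finset α} (hA : A ⊆ S) (hA' : A' ⊆ S) :
    bern p S (fun B => cen p A B * cen p A' B) =
      p ^ (A ∪ A').card - p ^ A.card * p ^ A'.card := by
  have : ∀ B, cen p A B * cen p A' B = ind (A ∪ A') B - p ^ A'.card * ind A B -
      (p ^ A.card * ind A' B - p ^ A.card * p ^ A'.card) := fun B => by
    rw [← ind_mul, cen, cen]
    ring
  simp only [this]
  rw [bern_sub, bern_sub, bern_sub, bern_const_mul, bern_const_mul, bern_const,
    bern_ind p (Finset.union_subset hA hA'), bern_ind p hA, bern_ind p hA']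
  ring

/-- Lower bound for the variance of the number of sets `A i` in a random set. -/
theorem le_bern_sq_sum_cen {p : ℝ} (h0 : 0 ≤ p) (h1 : p ≤ 1) {S : Finset α} {A : ι → Finset α}
    (hAS : ∀ i, A i ⊆ S) :
    (1 - p) * ∑ i, ∑ j, meet (A j) (A i) * p ^ (A i ∪ A j).card ≤
      bern p S (fun B => (∑ i, cen p (A i) B) ^ 2) := by
  rw [bern_sq_sum_cen p hAS, Finset.mul_sum]
  refine Finset.sum_le_sum fun i _ => ?_
  rw [Finset.mul_sum]
  refine Finset.sum_le_sum fun j _ => ?_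
  rw [bern_cen_mul_cen p (hAS i) (hAS j)]
  unfold meet
  split_ifs with h
  · simp
  · have hcard : (A i).card + (A j).card = (A i ∪ A j).card + (A i ∩ A j).card :=
      (Finset.card_union_add_card_inter _ _).symm
    have hpos : (A i ∩ A j).card ≠ 0 := by
      rw [Finset.card_ne_zero, ← Finset.not_disjoint_iff_nonempty_inter]
      exact fun h' => h h'.symm
    -- The covariance is p^|A i ∪ A j| (1 − p^|A i ∩ A j|), and a nonempty intersection makes the
    -- second factor at least 1 − p.
    have hle : p ^ (A i ∩ A j).card ≤ p := pow_le_of_le_one h0 h1 hpos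
    rw [← pow_add, hcard, pow_add]
    have : 0 ≤ p ^ (A i ∪ A j).card := by positivity
    nlinarith

/-- Approximate Stein identity for the number of sets `A i` in a random set. -/
theorem abs_bern_stein_le {p : ℝ} (h0 : 0 ≤ p) (h1 : p ≤ 1) {S : Finset α} {A : ι → Finset α}
    (hAS : ∀ i, A i ⊆ S) {e L : ℕ} (hA : ∀ i, (A i).card ≤ e) (hL : 2 * e ≤ L) {D : ℝ}
    (hD : IntersectionBound p A L D) {f f' : ℝ → ℝ} {K : ℝ} (hK : 0 ≤ K)
    (hf : ∀ x y, |f x - f (x - y) - y * f' x| ≤ K * y ^ 2)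
    (hf' : ∀ x y, |f' x - f' (x - y)| ≤ K * |y|) :
    |bern p S (fun B => (∑ i, cen p (A i) B) * f (∑ i, cen p (A i) B)) -
      bern p S (fun B => (∑ i, cen p (A i) B) ^ 2) *
        bern p S (fun B => f' (∑ i, cen p (A i) B))| ≤
      3 * K * ((16 + 2 * e * 8 ^ e) * (1 - p)) * ((∑ i, p ^ (A i).card) * D ^ 2) := by
  set q := (16 + 2 * (e : ℝ) * 8 ^ e) * (1 - p) with hq
  have hq0 : 0 ≤ q := mul_nonneg (by positivity) (by linarith)
  set W : Finset α → ℝ := fun B => ∑ i, cen p (A i) B with hW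
  set Y : ι → Finset α → ℝ := fun i B => cen p (A i) B with hY
  set η : Finset α → Finset α → ℝ := fun U B => ∑ i, meet (A i) U * cen p (A i) B with hη
  set b : ι → ι → ι → ℝ := fun i j k => meet (A j) (A i) *
    (meet (A k) (A i ∪ A j) * p ^ (A i ∪ A j ∪ A k).card) with hb
  have h3 : ∀ i j k, bern p S (fun B => |Y i B * Y j B * Y k B|) ≤
      q * p ^ (A i ∪ A j ∪ A k).card := fun i j k =>
    bern_abs_cen_mul_mul_le h0 h1 (hAS i) (hAS j) (hAS k) (hA i) (hA j) (hA k)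
  have h21 : ∀ i j k, bern p S (fun B => |Y i B * Y j B|) * bern p S (fun B => |Y k B|) ≤
      q * p ^ (A i ∪ A j ∪ A k).card := fun i j k =>
    bern_abs_cen_mul_mul_bern_le h0 h1 (hAS i) (hAS j) (hAS k) (hA i) (hA j) (hA k)
  -- Taylor expansion around W: removing the part η of W that meets A i makes f independent of Y i,
  -- so the zeroth-order term vanishes. The first-order term is the sum over j, and the remainder
  -- Kη² is a double sum over j and k.
  have step1 : ∀ i, |bern p S (fun B => Y i B * f (W B)) -
      ∑ j, meet (A j) (A i) * bern p S (fun B => Y i B * Y j B * f' (W B))| ≤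
      K * q * ∑ j, ∑ k, b i j k := by
    intro i
    have hzero : bern p S (fun B => Y i B * f (W B - η (A i) B)) = 0 := by
      have := bern_mul_comp_sum_eq p S A (A i) (Y i) (fun a ha B => cen_insert p ha B) f
      rw [show bern p S (Y i) = 0 from bern_cen p (hAS i), zero_mul] at this
      exact this
    have heq : bern p S (fun B => Y i B * f (W B)) -
        ∑ j, meet (A j) (A i) * bern p S (fun B => Y i B * Y j B * f' (W B)) =
        bern p S (fun B => Y i B * (f (W B) - f (W B - η (A i) B) - η (A i) B * f' (W B))) := by
      have : ∀ B, Y i B * (f (W B) - f (W B - η (A i) B) - η (A i) B * f' (W B)) =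
          Y i B * f (W B) - Y i B * f (W B - η (A i) B) -
            ∑ j, meet (A j) (A i) * (Y i B * Y j B * f' (W B)) := fun B => by
        simp only [hη, Finset.sum_mul, mul_sub, Finset.mul_sum]
        congr 1
        exact Finset.sum_congr rfl fun j _ => by ring
      simp only [this]
      rw [bern_sub, bern_sub, hzero, bern_sum, sub_zero]
      simp only [bern_const_mul]
    rw [heq]
    refine (abs_bern_le h0 h1 S _).trans ?_
    have hpt : ∀ B, |Y i B * (f (W B) - f (W B - η (A i) B) - η (A i) B * f' (W B))| ≤
        K * ∑ j, ∑ k, meet (A j) (A i) * (meet (A k) (A i ∪ A j) * |Y i B * Y j B * Y k B|) := by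
      intro B
      rw [abs_mul]
      refine (mul_le_mul_of_nonneg_left (hf _ _) (abs_nonneg _)).trans ?_
      rw [mul_left_comm]
      refine mul_le_mul_of_nonneg_left ?_ hK
      rw [sq, hη, Finset.sum_mul_sum, Finset.mul_sum]
      refine Finset.sum_le_sum fun j _ => ?_
      rw [Finset.mul_sum]
      refine Finset.sum_le_sum fun k _ => ?_
      have hm := meet_mono (A k) (Finset.subset_union_left (s₁ := A i) (s₂ := A j))
      have hmj := meet_nonneg (A j) (A i)
      have hmk := meet_nonneg (A k) (A i)
      calc _ ≤ |(|Y i B|) * (meet (A j) (A i) * Y j B * (meet (A k) (A i) * Y k B))| :=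
            le_abs_self _
        _ = meet (A j) (A i) * (meet (A k) (A i) * |Y i B * Y j B * Y k B|) := by
            simp only [abs_mul, abs_abs, abs_of_nonneg hmj, abs_of_nonneg hmk]
            ring
        _ ≤ _ := by gcongr
    refine (bern_mono h0 h1 S fun B _ => hpt B).trans ?_
    rw [bern_const_mul, bern_sum, mul_assoc]
    refine mul_le_mul_of_nonneg_left ?_ hK
    rw [Finset.mul_sum]
    refine Finset.sum_le_sum fun j _ => ?_
    rw [bern_sum, Finset.mul_sum]
    refine Finset.sum_le_sum fun k _ => ?_
    rw [bern_const_mul, bern_const_mul]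
    refine (mul_le_mul_of_nonneg_left (mul_le_mul_of_nonneg_left (h3 i j k)
      (meet_nonneg _ _)) (meet_nonneg _ _)).trans_eq ?_
    simp only [hb]
    ring
  -- Decouples f' from Y i * Y j: `e1` replaces W by the part independent of A i ∪ A j, the
  -- expectation then factorizes, and `e2` puts W back. Each replacement costs one factor K, which
  -- explains the 2.
  have step2 : ∀ i j, |meet (A j) (A i) * bern p S (fun B => Y i B * Y j B * f' (W B)) -
      meet (A j) (A i) * bern p S (fun B => Y i B * Y j B) * bern p S (fun B => f' (W B))| ≤
      2 * K * q * ∑ k, b i j k := by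
    intro i j
    set U := A i ∪ A j with hU
    have hind := bern_mul_comp_sum_eq p S A U (fun B => Y i B * Y j B) (fun a ha B => by
      have ha := Finset.notMem_union.1 ha
      simp only [hY]
      rw [cen_insert p ha.1, cen_insert p ha.2]) f'
    change bern p S (fun B => Y i B * Y j B * f' (W B - η U B)) =
      _ * bern p S (fun B => f' (W B - η U B)) at hind
    have habs : ∀ B, |η U B| ≤ ∑ k, meet (A k) U * |Y k B| := fun B => by
      refine (Finset.abs_sum_le_sum_abs _ _).trans_eq (Finset.sum_congr rfl fun k _ => ?_)
      rw [abs_mul, abs_of_nonneg (meet_nonneg _ _)]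
    have e1 : |bern p S (fun B => Y i B * Y j B * f' (W B)) -
        bern p S (fun B => Y i B * Y j B * f' (W B - η U B))| ≤
        K * q * ∑ k, meet (A k) U * p ^ (U ∪ A k).card := by
      rw [← bern_sub]
      refine (abs_bern_le h0 h1 S _).trans ?_
      calc _ ≤ bern p S (fun B => K * ∑ k, meet (A k) U * |Y i B * Y j B * Y k B|) := by
            refine bern_mono h0 h1 S fun B _ => ?_
            rw [← mul_sub, abs_mul]
            refine (mul_le_mul_of_nonneg_left ((hf' _ _).trans
              (mul_le_mul_of_nonneg_left (habs B) hK)) (abs_nonneg _)).trans_eq ?_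
            rw [mul_left_comm, Finset.mul_sum]
            congr 1
            refine Finset.sum_congr rfl fun k _ => ?_
            rw [abs_mul (Y i B * Y j B)]
            ring
        _ ≤ _ := by
            rw [bern_const_mul, bern_sum, mul_assoc]
            refine mul_le_mul_of_nonneg_left ?_ hK
            rw [Finset.mul_sum]
            refine Finset.sum_le_sum fun k _ => ?_
            rw [bern_const_mul, mul_left_comm]
            exact mul_le_mul_of_nonneg_left (h3 i j k) (meet_nonneg _ _)
    have e2 : |bern p S (fun B => Y i B * Y j B) * bern p S (fun B => f' (W B - η U B)) -
        bern p S (fun B => Y i B * Y j B) * bern p S (fun B => f' (W B))| ≤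
        K * q * ∑ k, meet (A k) U * p ^ (U ∪ A k).card := by
      have hl : |bern p S (fun B => f' (W B - η U B)) - bern p S (fun B => f' (W B))| ≤
          K * ∑ k, meet (A k) U * bern p S (fun B => |Y k B|) := by
        rw [← bern_sub]
        refine (abs_bern_le h0 h1 S _).trans ?_
        calc _ ≤ bern p S (fun B => K * ∑ k, meet (A k) U * |Y k B|) := by
              refine bern_mono h0 h1 S fun B _ => ?_
              rw [abs_sub_comm]
              exact (hf' _ _).trans (mul_le_mul_of_nonneg_left (habs B) hK)
          _ = _ := by
              rw [bern_const_mul, bern_sum]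
              simp only [bern_const_mul]
      rw [← mul_sub, abs_mul]
      refine (mul_le_mul (abs_bern_le h0 h1 S _) hl (abs_nonneg _)
        (bern_nonneg h0 h1 S fun _ _ => abs_nonneg _)).trans ?_
      rw [mul_left_comm, mul_assoc]
      refine mul_le_mul_of_nonneg_left ?_ hK
      rw [Finset.mul_sum, Finset.mul_sum]
      refine Finset.sum_le_sum fun k _ => ?_
      rw [mul_left_comm, mul_left_comm q]
      exact mul_le_mul_of_nonneg_left (h21 i j k) (meet_nonneg _ _)
    rw [hind] at e1
    rw [mul_assoc, ← mul_sub, abs_mul, abs_of_nonneg (meet_nonneg _ _)]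
    refine (mul_le_mul_of_nonneg_left ((abs_sub_le _ _ _).trans (add_le_add e1 e2))
      (meet_nonneg _ _)).trans_eq ?_
    simp only [hb]
    rw [← Finset.mul_sum]
    ring
  have hsum : bern p S (fun B => W B * f (W B)) = ∑ i, bern p S (fun B => Y i B * f (W B)) := by
    rw [← bern_sum]
    refine bern_congr _ _ fun B _ => ?_
    rw [← Finset.sum_mul]
  have hV : bern p S (fun B => W B ^ 2) * bern p S (fun B => f' (W B)) =
      ∑ i, ∑ j, meet (A j) (A i) * bern p S (fun B => Y i B * Y j B) *
        bern p S (fun B => f' (W B)) := by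
    rw [hW, bern_sq_sum_cen p hAS, Finset.sum_mul]
    exact Finset.sum_congr rfl fun i _ => by rw [Finset.sum_mul]
  rw [hsum, hV, ← Finset.sum_sub_distrib]
  refine (Finset.abs_sum_le_sum_abs _ _).trans ?_
  calc _ ≤ ∑ i, 3 * K * q * ∑ j, ∑ k, b i j k := by
        refine Finset.sum_le_sum fun i _ => ?_
        have h2 : |∑ j, meet (A j) (A i) * bern p S (fun B => Y i B * Y j B * f' (W B)) -
            ∑ j, meet (A j) (A i) * bern p S (fun B => Y i B * Y j B) *
              bern p S (fun B => f' (W B))| ≤ 2 * K * q * ∑ j, ∑ k, b i j k := by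
          rw [← Finset.sum_sub_distrib, Finset.mul_sum]
          exact (Finset.abs_sum_le_sum_abs _ _).trans (Finset.sum_le_sum fun j _ => step2 i j)
        exact (abs_sub_le _ _ _).trans ((add_le_add (step1 i) h2).trans_eq (by ring))
    _ ≤ _ := by
        rw [← Finset.mul_sum]
        exact mul_le_mul_of_nonneg_left (sum_sum_sum_meet_le h0 hA hL hD) (by positivity)

/-- Small ball estimate for the number of sets `A i` in a random set, where `s` is the standard
deviation. -/
theorem bern_small_ball_le {p : ℝ} (h0 : 0 ≤ p) (h1 : p ≤ 1) {S : Finset α} {A : ι → Finset α}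
    (hAS : ∀ i, A i ⊆ S) {e L : ℕ} (hA : ∀ i, (A i).card ≤ e) (hL : 2 * e ≤ L) {D : ℝ}
    (hD : IntersectionBound p A L D) {s : ℝ} (hs : 0 < s)
    (hV : bern p S (fun B => (∑ i, cen p (A i) B) ^ 2) = s ^ 2) {δ : ℝ} (hδ : 0 < δ) :
    bern p S (fun B => if |∑ i, cen p (A i) B| ≤ δ * s then 1 else 0) ≤
      4 * δ + 6 / δ * ((16 + 2 * e * 8 ^ e) * (1 - p)) * ((∑ i, p ^ (A i).card) * D ^ 2) /
        s ^ 3 := by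
  have hh : 0 < δ * s := by positivity
  -- The test function at scale h = δs, whose Taylor and Lipschitz constants are both 2/h.
  have key := abs_bern_stein_le h0 h1 hAS hA hL hD (K := 2 / (δ * s)) (by positivity)
    (f := fun x => 2 * (δ * s) * Real.arctan (x / (δ * s)))
    (f' := fun x => 2 / (1 + (x / (δ * s)) ^ 2)) (fun x y => abs_arctan_taylor_le hh x y)
    (fun x y => by simpa using abs_two_div_one_add_div_sq_sub_le hh x (x - y))
  rw [hV] at key
  set W : Finset α → ℝ := fun B => ∑ i, cen p (A i) B with hW
  have hP : bern p S (fun B => if |W B| ≤ δ * s then 1 else 0) ≤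
      bern p S (fun B => 2 / (1 + (W B / (δ * s)) ^ 2)) := by
    refine bern_mono h0 h1 S fun B _ => ?_
    split_ifs with h
    · rw [le_div_iff₀ (by positivity), one_mul]
      have : (W B / (δ * s)) ^ 2 ≤ 1 := by
        rw [sq_le_one_iff_abs_le_one, abs_div, abs_of_pos hh]
        exact (div_le_one hh).2 h
      linarith
    · positivity
  -- Uses |arctan| ≤ 2 and 2s|W| ≤ W² + s², whose mean is 2s².
  have hWf : bern p S (fun B => W B * (2 * (δ * s) * Real.arctan (W B / (δ * s)))) ≤
      4 * (δ * s) * s := by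
    calc _ ≤ bern p S (fun B => 2 * δ * (W B ^ 2 + s ^ 2)) := by
          refine bern_mono h0 h1 S fun B _ => ?_
          have hat : |Real.arctan (W B / (δ * s))| ≤ 2 := by
            have := Real.arctan_lt_pi_div_two (W B / (δ * s))
            have := Real.neg_pi_div_two_lt_arctan (W B / (δ * s))
            have := Real.pi_le_four
            rw [abs_le]
            constructor <;> linarith
          have h2 : W B * Real.arctan (W B / (δ * s)) ≤ |W B| * 2 := by
            refine (le_abs_self _).trans ?_
            rw [abs_mul]
            exact mul_le_mul_of_nonneg_left hat (abs_nonneg _)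
          have h3 : 2 * (s * |W B|) ≤ W B ^ 2 + s ^ 2 := by
            nlinarith [sq_nonneg (|W B| - s), sq_abs (W B)]
          calc _ = 2 * δ * (s * (W B * Real.arctan (W B / (δ * s)))) := by ring
            _ ≤ 2 * δ * (s * (|W B| * 2)) := by gcongr
            _ = 2 * δ * (2 * (s * |W B|)) := by ring
            _ ≤ _ := by gcongr
      _ = _ := by
          rw [bern_const_mul, bern_add, bern_const, hV]
          ring
  have h5 := (abs_le.1 key).1
  have h6 : s ^ 2 * bern p S (fun B => if |W B| ≤ δ * s then 1 else 0) ≤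
      4 * (δ * s) * s + 3 * (2 / (δ * s)) * ((16 + 2 * e * 8 ^ e) * (1 - p)) *
        ((∑ i, p ^ (A i).card) * D ^ 2) := by
    have := mul_le_mul_of_nonneg_left hP (sq_nonneg s)
    linarith
  rw [← mul_le_mul_iff_right₀ (show 0 < s ^ 2 by positivity)]
  refine h6.trans_eq ?_
  field_simp
  ring

end SmallBall

/-! ### The binomial random graph as a random set of edges. -/

section BinomialRandomGraph

/-- The set of possible edges of a graph on `Fin n`. -/
def edgeSlots (n : ℕ) : Finset (Sym2 (Fin n)) := Finset.univ.filter fun s => ¬ s.IsDiag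

theorem card_edgeSlots (n : ℕ) : (edgeSlots n).card = n.choose 2 := by
  have := Sym2.card_subtype_not_diag (α := Fin n)
  rw [Fintype.card_subtype, Fintype.card_fin] at this
  exact this

theorem integral_binomialRandom (n : ℕ) (p : unitInterval) (f : SimpleGraph (Fin n) → ℝ) :
    ∫ Γ, f Γ ∂(SimpleGraph.binomialRandom (Fin n) p) =
      bern p (edgeSlots n) fun B => f (SimpleGraph.fromEdgeSet (B : Set (Sym2 (Fin n)))) := by
  classical
  have : MeasurableSingletonClass (SimpleGraph (Fin n)) := ⟨fun _ => measurableSet_simpleGraph _⟩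
  rw [integral_fintype (.of_finite), bern]
  refine Finset.sum_bij' (fun Γ _ => (Set.toFinite Γ.edgeSet).toFinset)
    (fun B _ => SimpleGraph.fromEdgeSet (B : Set (Sym2 (Fin n)))) ?_ ?_ ?_ ?_ ?_
  · intro Γ _
    rw [Finset.mem_powerset]
    intro s hs
    rw [edgeSlots, Finset.mem_filter]
    exact ⟨Finset.mem_univ _, Γ.not_isDiag_of_mem_edgeSet ((Set.Finite.mem_toFinset _).1 hs)⟩
  · intro B _
    exact Finset.mem_univ _
  · intro Γ _
    rw [Set.Finite.coe_toFinset, SimpleGraph.fromEdgeSet_edgeSet]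
  · intro B hB
    ext s
    refine (Set.Finite.mem_toFinset _).trans ?_
    rw [SimpleGraph.edgeSet_fromEdgeSet, Set.mem_sdiff]
    constructor
    · exact fun h => h.1
    · intro h
      exact ⟨h, (Finset.mem_filter.1 (Finset.mem_powerset.1 hB h)).2⟩
  · intro Γ _
    rw [Set.Finite.coe_toFinset, SimpleGraph.fromEdgeSet_edgeSet, measureReal_def,
      SimpleGraph.binomialRandom_singleton, card_edgeSlots, Nat.card_fin,
      Set.ncard_eq_toFinset_card]
    simp

theorem binomialRandom_real_setOf (n : ℕ) (p : unitInterval) (P : SimpleGraph (Fin n) → Prop)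
    [DecidablePred P] :
    (SimpleGraph.binomialRandom (Fin n) p).real {Γ | P Γ} =
      bern p (edgeSlots n) fun B =>
        if P (SimpleGraph.fromEdgeSet (B : Set (Sym2 (Fin n)))) then 1 else 0 := by
  rw [← integral_indicator_one (measurableSet_simpleGraph _), integral_binomialRandom]
  refine bern_congr _ _ fun B _ => ?_
  simp [Set.indicator_apply]

end BinomialRandomGraph

/-! ### Extensions as images of placements, counted up to root-fixing automorphisms. -/

namespace RootedGraph

variable {k : ℕ} {V W : Type*}

section Homs

variable (F : RootedGraph k V) (Γ : SimpleGraph W) (x : Fin k ↪ W)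

/-- The injective homomorphisms from `H_G` to `Γ` that map each root `j` to `x j`. -/
def Homs : Type _ :=
  {φ : V ↪ W // (∀ j, φ (F.root j) = x j) ∧ ∀ a b, F.extGraph.Adj a b → Γ.Adj (φ a) (φ b)}

/-- The automorphisms of `H_G` that fix all roots. -/
def Auts : Type _ := {σ : F.extGraph ≃g F.extGraph // ∀ j, σ (F.root j) = F.root j}

variable {F Γ x}

/-- The image of an injective homomorphism. -/
def Homs.image (h : F.Homs Γ x) : Γ.Subgraph where
  verts := Set.range h.1
  Adj u v := ∃ a b, F.extGraph.Adj a b ∧ h.1 a = u ∧ h.1 b = v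
  adj_sub := by
    rintro u v ⟨a, b, hab, rfl, rfl⟩
    exact h.2.2 a b hab
  edge_vert := by
    rintro u v ⟨a, b, hab, rfl, rfl⟩
    exact Set.mem_range_self a
  symm := ⟨by
    rintro u v ⟨a, b, hab, rfl, rfl⟩
    exact ⟨b, a, hab.symm, rfl, rfl⟩⟩

/-- An injective homomorphism as an isomorphism onto its image. -/
noncomputable def Homs.iso (h : F.Homs Γ x) : F.extGraph ≃g h.image.coe where
  toEquiv := Equiv.ofInjective h.1 h.1.injective
  map_rel_iff' := by
    intro a b
    rw [SimpleGraph.Subgraph.coe_adj]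
    constructor
    · rintro ⟨c, d, hcd, hc, hd⟩
      have hc := h.1.injective hc
      have hd := h.1.injective hd
      exact hc ▸ hd ▸ hcd
    · intro hab
      exact ⟨a, b, hab, rfl, rfl⟩

theorem Homs.image_mem (h : F.Homs Γ x) : h.image ∈ F.extensions Γ x :=
  ⟨h.iso, fun j => h.2.1 j⟩

/-- The injective homomorphism given by an isomorphism onto a subgraph. -/
def homsOfIso {K : Γ.Subgraph} (ψ : F.extGraph ≃g K.coe) (hψ : ∀ j, (ψ (F.root j) : W) = x j) :
    F.Homs Γ x :=
  ⟨⟨fun v => (ψ v : W), fun _ _ hab => ψ.injective (Subtype.ext hab)⟩, hψ,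
    fun _ _ hab => K.adj_sub (ψ.map_rel_iff.2 hab)⟩

theorem image_homsOfIso {K : Γ.Subgraph} (ψ : F.extGraph ≃g K.coe)
    (hψ : ∀ j, (ψ (F.root j) : W) = x j) : (homsOfIso ψ hψ).image = K := by
  ext u v
  · constructor
    · rintro ⟨a, rfl⟩
      exact (ψ a).2
    · intro hu
      exact ⟨ψ.symm ⟨u, hu⟩, congrArg Subtype.val (ψ.apply_symm_apply ⟨u, hu⟩)⟩
  · constructor
    · rintro ⟨a, b, hab, rfl, rfl⟩
      exact ψ.map_rel_iff.2 hab
    · intro huv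
      refine ⟨ψ.symm ⟨u, K.edge_vert huv⟩, ψ.symm ⟨v, K.edge_vert huv.symm⟩, ?_,
        congrArg Subtype.val (ψ.apply_symm_apply _), congrArg Subtype.val (ψ.apply_symm_apply _)⟩
      rw [← ψ.map_rel_iff]
      simpa using huv

variable (F Γ x)

/-- Once one isomorphism ψ onto K is fixed, all others arise from it by composing with a unique
root-fixing automorphism. -/
theorem card_homs_fiber {K : Γ.Subgraph} (hK : K ∈ F.extensions Γ x) :
    Nat.card {h : F.Homs Γ x // h.image = K} = Nat.card F.Auts := by
  obtain ⟨ψ, hψ⟩ := hK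
  have hroot : ∀ (σ : F.Auts) j, ((σ.1.trans ψ) (F.root j) : W) = x j := fun σ j => by
    rw [← hψ j]
    change (ψ (σ.1 (F.root j)) : W) = _
    rw [σ.2 j]
  symm
  refine Nat.card_eq_of_bijective
    (fun σ => ⟨homsOfIso (σ.1.trans ψ) (hroot σ), image_homsOfIso _ _⟩) ⟨?_, ?_⟩
  · intro σ τ h
    refine Subtype.ext (RelIso.ext fun v => ?_)
    have h1 := congrArg Subtype.val (congrArg Subtype.val h)
    have h2 := DFunLike.congr_fun h1 v
    exact ψ.injective (Subtype.ext h2)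
  · rintro ⟨h, rfl⟩
    refine ⟨⟨h.iso.trans ψ.symm, fun j => ?_⟩, ?_⟩
    · change ψ.symm (h.iso (F.root j)) = _
      rw [RelIso.symm_apply_eq]
      exact Subtype.ext ((h.2.1 j).trans (hψ j).symm)
    · refine Subtype.ext (Subtype.ext (DFunLike.ext _ _ fun v => ?_))
      change (ψ (ψ.symm (h.iso v)) : W) = h.1 v
      rw [RelIso.apply_symm_apply]
      rfl

instance [Finite V] [Finite W] : Finite (F.Homs Γ x) := Subtype.finite

theorem card_homs [Finite V] [Finite W] :
    Nat.card (F.Homs Γ x) = F.count Γ x * Nat.card F.Auts := by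
  classical
  let g : F.Homs Γ x → F.extensions Γ x := fun h => ⟨h.image, h.image_mem⟩
  let _ : Fintype (F.extensions Γ x) := Fintype.ofFinite _
  rw [← Nat.card_congr (Equiv.sigmaFiberEquiv g), Nat.card_sigma, count]
  have : ∀ K : F.extensions Γ x, Nat.card {h // g h = K} = Nat.card F.Auts := by
    intro K
    rw [← F.card_homs_fiber Γ x K.2]
    exact Nat.card_congr (Equiv.subtypeEquivRight fun h => Subtype.ext_iff)
  simp only [this]
  rw [Finset.sum_const, smul_eq_mul, Finset.card_univ, ← Nat.card_eq_fintype_card,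
    Nat.card_coe_set_eq]

instance [Finite V] : Finite F.Auts :=
  Finite.of_injective (fun σ : F.Auts => (σ.1 : V → V)) fun _ _ h =>
    Subtype.ext (RelIso.ext fun v => congrFun h v)

theorem card_auts_pos [Finite V] : 0 < Nat.card F.Auts :=
  have : Nonempty F.Auts := ⟨⟨RelIso.refl _, fun _ => rfl⟩⟩
  Nat.card_pos

end Homs

section Reps

variable [Finite V] (F : RootedGraph k V)

/-- The edges of `H_G`. -/
noncomputable def extEdges : Finset (Sym2 V) := (Set.toFinite F.extGraph.edgeSet).toFinset

theorem mem_extEdges {s : Sym2 V} : s ∈ F.extEdges ↔ s ∈ F.extGraph.edgeSet :=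
  Set.Finite.mem_toFinset _

/-- The placements of the vertices of `H` that map each root `j` to `x j`. -/
def Reps (x : Fin k ↪ W) : Type _ := {φ : V ↪ W // ∀ j, φ (F.root j) = x j}

noncomputable instance [Finite W] (x : Fin k ↪ W) : Fintype (F.Reps x) :=
  have : Finite (F.Reps x) := Subtype.finite
  Fintype.ofFinite _

/-- The edges of the copy of `H_G` given by a placement of the vertices. -/
noncomputable def edges {x : Fin k ↪ W} (φ : F.Reps x) : Finset (Sym2 W) :=
  F.extEdges.map φ.1.sym2Map

theorem card_edges {x : Fin k ↪ W} (φ : F.Reps x) : (F.edges φ).card = F.extEdges.card :=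
  Finset.card_map _

theorem edges_subset {n : ℕ} {x : Fin k ↪ Fin n} (φ : F.Reps x) : F.edges φ ⊆ edgeSlots n := by
  intro s hs
  obtain ⟨t, ht, rfl⟩ := Finset.mem_map.1 hs
  rw [edgeSlots, Finset.mem_filter]
  refine ⟨Finset.mem_univ _, ?_⟩
  rw [mem_extEdges] at ht
  change ¬ (Sym2.map φ.1 t).IsDiag
  rw [Sym2.isDiag_map φ.1.injective]
  exact F.extGraph.not_isDiag_of_mem_edgeSet ht

theorem edges_subset_iff {n : ℕ} {x : Fin k ↪ Fin n} (φ : F.Reps x)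
    (B : Finset (Sym2 (Fin n))) :
    F.edges φ ⊆ B ↔ ∀ a b, F.extGraph.Adj a b →
      (SimpleGraph.fromEdgeSet (B : Set (Sym2 (Fin n)))).Adj (φ.1 a) (φ.1 b) := by
  constructor
  · intro h a b hab
    rw [SimpleGraph.fromEdgeSet_adj]
    refine ⟨h (Finset.mem_map.2 ⟨s(a, b), F.mem_extEdges.2 hab, rfl⟩), fun h' => hab.ne ?_⟩
    exact φ.1.injective h'
  · intro h s hs
    obtain ⟨t, ht, rfl⟩ := Finset.mem_map.1 hs
    rw [mem_extEdges] at ht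
    induction t with
    | h a b =>
      exact ((SimpleGraph.fromEdgeSet_adj _).1 (h a b ht)).1

theorem count_mul_card_auts {n : ℕ} (x : Fin k ↪ Fin n) (B : Finset (Sym2 (Fin n))) :
    (F.count (SimpleGraph.fromEdgeSet (B : Set (Sym2 (Fin n)))) x : ℝ) * Nat.card F.Auts =
      ∑ φ : F.Reps x, ind (F.edges φ) B := by
  classical
  rw [← Nat.cast_mul, ← card_homs]
  unfold ind
  rw [Finset.sum_boole, ← Fintype.card_subtype, ← Nat.card_eq_fintype_card]
  congr 1
  refine Nat.card_congr ((Equiv.subtypeSubtypeEquivSubtypeInter _ _).symm.trans ?_)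
  exact Equiv.subtypeEquivRight fun φ => (F.edges_subset_iff φ B).symm

theorem expectation_mul_card_auts {n : ℕ} (p : unitInterval) (x : Fin k ↪ Fin n) :
    F.expectation n p x * Nat.card F.Auts =
      Fintype.card (F.Reps x) * (p : ℝ) ^ F.extEdges.card := by
  rw [expectation, integral_binomialRandom, mul_comm, ← bern_const_mul]
  simp only [mul_comm (Nat.card F.Auts : ℝ), F.count_mul_card_auts]
  rw [bern_sum]
  simp only [bern_ind _ (F.edges_subset _), card_edges]
  simp

theorem sum_pow_card_edges {n : ℕ} (p : unitInterval) (x : Fin k ↪ Fin n) :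
    ∑ φ : F.Reps x, (p : ℝ) ^ (F.edges φ).card = Nat.card F.Auts * F.mu n p := by
  rw [← F.expectation_eq_mu n p x, mul_comm, expectation_mul_card_auts]
  simp [card_edges]

theorem card_auts_mul_count_sub_mu {n : ℕ} (p : unitInterval) (x : Fin k ↪ Fin n)
    (B : Finset (Sym2 (Fin n))) :
    Nat.card F.Auts *
      ((F.count (SimpleGraph.fromEdgeSet (B : Set (Sym2 (Fin n)))) x : ℝ) - F.mu n p) =
      ∑ φ : F.Reps x, cen p (F.edges φ) B := by
  unfold cen
  rw [Finset.sum_sub_distrib, ← count_mul_card_auts, sum_pow_card_edges]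
  ring

end Reps

end RootedGraph

/-! ### Counting placements, and pairs of placements that share edges. -/

/-- The number of extensions of an injective map `f` on `T` to an injective map on `V`. -/
theorem le_card_extend {V : Type*} [Finite V] {n : ℕ} (hn : 2 * Nat.card V ≤ n) (T : Set V)
    (f : T ↪ Fin n) :
    ((n : ℝ) / 2) ^ (Nat.card V - T.ncard) ≤ Nat.card {φ : V ↪ Fin n // ∀ t : T, φ t = f t} := by
  classical
  have hfin : Finite {φ : V ↪ Fin n // ∀ t : T, φ t = f t} := Subtype.finite
  have hmem : ∀ (g : ↥Tᶜ ↪ ↥(Set.range f)ᶜ) (t : T) (v : ↥Tᶜ), f t ≠ (g v : Fin n) :=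
    fun g t v h => (g v).2 ⟨t, h⟩
  let Ψ : (↥Tᶜ ↪ ↥(Set.range f)ᶜ) → {φ : V ↪ Fin n // ∀ t : T, φ t = f t} := fun g =>
    ⟨⟨fun v => if h : v ∈ T then f ⟨v, h⟩ else (g ⟨v, h⟩ : Fin n), fun v w hvw => by
      dsimp only at hvw
      split_ifs at hvw with hv hw hw
      · exact congrArg Subtype.val (f.injective hvw)
      · exact absurd hvw (hmem g _ _)
      · exact absurd hvw.symm (hmem g _ _)
      · exact congrArg Subtype.val (g.injective (Subtype.ext hvw))⟩, fun t => dif_pos t.2⟩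
  have hΨ : Function.Injective Ψ := by
    intro g g' h
    ext v
    have h1 := DFunLike.congr_fun (congrArg Subtype.val h) (v : V)
    have hv : (v : V) ∉ T := v.2
    change (dite _ _ _ : Fin n) = dite _ _ _ at h1
    rw [dif_neg hv, dif_neg hv] at h1
    exact congrArg Fin.val h1
  have hle := Nat.card_le_card_of_injective Ψ hΨ
  have hV := Set.ncard_add_ncard_compl T
  have hT : T.ncard ≤ Nat.card V := by omega
  have hc1 : Nat.card ↥Tᶜ = Nat.card V - T.ncard := by
    rw [Nat.card_coe_set_eq]
    omega
  have hc2 : Nat.card ↥(Set.range f)ᶜ = n - T.ncard := by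
    have h1 := Set.ncard_add_ncard_compl (Set.range f)
    have h2 : (Set.range f).ncard = T.ncard := by
      rw [← Nat.card_coe_set_eq, ← Nat.card_coe_set_eq]
      exact Nat.card_range_of_injective f.injective
    rw [Nat.card_coe_set_eq]
    rw [Nat.card_fin] at h1
    omega
  have hcard : Nat.card (↥Tᶜ ↪ ↥(Set.range f)ᶜ) =
      (n - T.ncard).descFactorial (Nat.card V - T.ncard) := by
    have := Fintype.ofFinite ↥Tᶜ
    rw [Nat.card_eq_fintype_card, Fintype.card_embedding_eq, ← Nat.card_eq_fintype_card,
      ← Nat.card_eq_fintype_card, hc1, hc2]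
  rw [hcard] at hle
  have hlow := (Nat.pow_sub_le_descFactorial (n - T.ncard) (Nat.card V - T.ncard)).trans hle
  have hbase : (n : ℝ) / 2 ≤ ((n - T.ncard + 1 - (Nat.card V - T.ncard) : ℕ) : ℝ) := by
    have : n ≤ 2 * (n - T.ncard + 1 - (Nat.card V - T.ncard)) := by omega
    have h2 : (n : ℝ) ≤ 2 * ((n - T.ncard + 1 - (Nat.card V - T.ncard) : ℕ) : ℝ) := by
      exact_mod_cast this
    linarith
  calc _ ≤ ((n - T.ncard + 1 - (Nat.card V - T.ncard) : ℕ) : ℝ) ^ (Nat.card V - T.ncard) := by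
        gcongr
    _ ≤ _ := by exact_mod_cast hlow

namespace RootedGraph

variable {k : ℕ} {V W : Type*} (F : RootedGraph k V)

theorem ncard_range_root : (Set.range F.root).ncard = k := by
  rw [← Nat.card_coe_set_eq, Nat.card_range_of_injective F.root.injective, Nat.card_fin]

variable [Finite V]

/-- The non-root vertices that are covered by a set `E` of edges. -/
def freeVerts (E : Finset (Sym2 V)) : Set V := {v | v ∉ Set.range F.root ∧ ∃ s ∈ E, v ∈ s}

theorem ncard_union_freeVerts (E : Finset (Sym2 V)) :
    (Set.range F.root ∪ F.freeVerts E).ncard = k + (F.freeVerts E).ncard := by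
  rw [Set.ncard_union_eq, ncard_range_root]
  exact Set.disjoint_left.2 fun v hv hv' => hv'.1 hv

theorem ncard_freeVerts_le (E : Finset (Sym2 V)) :
    k + (F.freeVerts E).ncard ≤ Nat.card V := by
  rw [← ncard_union_freeVerts]
  exact Set.ncard_le_card _

/-- The number of placements of `H` in which all edges in `E` are mapped into `U`. -/
theorem card_reps_map_mem_le {n : ℕ} (x : Fin k ↪ Fin n) (E : Finset (Sym2 V))
    (U : Finset (Sym2 (Fin n))) :
    Nat.card {φ : F.Reps x // ∀ s ∈ E, Sym2.map φ.1 s ∈ U} ≤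
      (2 * U.card) ^ (F.freeVerts E).ncard * n ^ (Nat.card V - k - (F.freeVerts E).ncard) := by
  classical
  have := Fintype.ofFinite V
  let verts : Finset (Fin n) := U.biUnion Sym2.toFinset
  have hverts : verts.card ≤ 2 * U.card := by
    rw [mul_comm]
    refine Finset.card_biUnion_le_card_mul _ _ _ fun s _ => ?_
    rw [Sym2.card_toFinset]
    split_ifs <;> norm_num
  -- The candidates for the image of v: a root has one, a vertex covered by E must go to one of the
  -- at most 2|U| endpoints of edges in U, and any other vertex is unrestricted.
  let b : V → Finset (Fin n) := fun v =>
    if h : v ∈ Set.range F.root then {x h.choose} else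
      if v ∈ F.freeVerts E then verts else Finset.univ
  have hb : ∀ (φ : {φ : F.Reps x // ∀ s ∈ E, Sym2.map φ.1 s ∈ U}) v, φ.1.1 v ∈ b v := by
    intro φ v
    simp only [b]
    split_ifs with h1 h2
    · rw [Finset.mem_singleton, ← φ.1.2 h1.choose, h1.choose_spec]
    · obtain ⟨s, hs, hv⟩ := h2.2
      exact Finset.mem_biUnion.2 ⟨_, φ.2 s hs, Sym2.mem_toFinset.2 (Sym2.mem_map.2 ⟨v, hv, rfl⟩)⟩
    · exact Finset.mem_univ _
  have hle : Nat.card {φ : F.Reps x // ∀ s ∈ E, Sym2.map φ.1 s ∈ U} ≤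
      (Fintype.piFinset b).card := by
    rw [← Nat.card_eq_finsetCard]
    refine Nat.card_le_card_of_injective
      (fun φ => ⟨fun v => φ.1.1 v, Fintype.mem_piFinset.2 (hb φ)⟩) fun φ ψ h => ?_
    exact Subtype.ext (Subtype.ext (DFunLike.coe_injective (congrArg Subtype.val h)))
  refine hle.trans ?_
  rw [Fintype.card_piFinset]
  calc ∏ v, (b v).card ≤ ∏ v, ((if v ∈ F.freeVerts E then 2 * U.card else 1) *
        (if v ∈ Set.range F.root ∪ F.freeVerts E then 1 else n)) := by
        refine Finset.prod_le_prod' fun v _ => ?_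
        simp only [b, Set.mem_union]
        by_cases h1 : v ∈ Set.range F.root
        · have h2 : v ∉ F.freeVerts E := fun h => h.1 h1
          simp [h1, h2]
        · by_cases h2 : v ∈ F.freeVerts E
          · simpa [h1, h2] using hverts
          · simp [h1, h2]
    _ = _ := by
        rw [Finset.prod_mul_distrib, Finset.prod_ite, Finset.prod_ite]
        simp only [Finset.prod_const, one_pow, mul_one, one_mul]
        have hf : (Finset.univ.filter fun v => v ∈ F.freeVerts E).card =
            (F.freeVerts E).ncard := by
          rw [Set.ncard_eq_toFinset_card']
          congr 1
          ext v
          simp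
        have hg : (Finset.univ.filter fun v => v ∉ Set.range F.root ∪ F.freeVerts E).card =
            Nat.card V - k - (F.freeVerts E).ncard := by
          have h1 := Set.ncard_add_ncard_compl (Set.range F.root ∪ F.freeVerts E)
          rw [ncard_union_freeVerts] at h1
          have h2 : (Finset.univ.filter fun v => v ∉ Set.range F.root ∪ F.freeVerts E) =
              (Set.range F.root ∪ F.freeVerts E)ᶜ.toFinset := by
            ext v
            simp
          rw [h2, ← Set.ncard_eq_toFinset_card']
          omega
        rw [hf, hg]

theorem card_reps_le {n : ℕ} (x : Fin k ↪ Fin n) :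
    Nat.card (F.Reps x) ≤ n ^ (Nat.card V - k) := by
  have h := F.card_reps_map_mem_le x ∅ ∅
  have h0 : (F.freeVerts ∅).ncard = 0 := by simp [freeVerts]
  rw [h0, pow_zero, one_mul, Nat.sub_zero] at h
  refine le_trans (le_of_eq ?_) h
  exact Nat.card_congr (Equiv.subtypeUnivEquiv fun φ => by simp).symm

theorem le_card_reps {n : ℕ} (hn : 2 * Nat.card V ≤ n) (x : Fin k ↪ Fin n) :
    ((n : ℝ) / 2) ^ (Nat.card V - k) ≤ Nat.card (F.Reps x) := by
  have h := le_card_extend hn (Set.range F.root)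
    ((Equiv.ofInjective F.root F.root.injective).symm.toEmbedding.trans x)
  rw [ncard_range_root] at h
  refine h.trans (le_of_eq ?_)
  congr 1
  refine Nat.card_congr (Equiv.subtypeEquivRight fun φ => ?_)
  constructor
  · intro h j
    simpa using h ⟨F.root j, Set.mem_range_self j⟩
  · rintro h ⟨_, j, rfl⟩
    simpa using h j

theorem map_filter_sdiff_card {n : ℕ} {x : Fin k ↪ Fin n} (φ : F.Reps x)
    (U : Finset (Sym2 (Fin n))) :
    (F.edges φ \ U).card =
      F.extEdges.card - (F.extEdges.filter fun s => Sym2.map φ.1 s ∈ U).card := by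
  classical
  have : F.edges φ \ U = (F.extEdges.filter fun s => Sym2.map φ.1 s ∉ U).map φ.1.sym2Map := by
    ext t
    simp only [edges, Finset.mem_sdiff, Finset.mem_map, Finset.mem_filter]
    constructor
    · rintro ⟨⟨s, hs, rfl⟩, ht⟩
      exact ⟨s, ⟨hs, ht⟩, rfl⟩
    · rintro ⟨s, ⟨hs, ht⟩, rfl⟩
      exact ⟨⟨s, hs, rfl⟩, ht⟩
  rw [this, Finset.card_map,
    ← Finset.card_filter_add_card_filter_not (s := F.extEdges) fun s => Sym2.map φ.1 s ∈ U]
  omega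

/-- Placements that meet U are sorted by the nonempty set E of edges landing in U (at most 2^e
choices, e = |E(H_G)|). For each E there are O(n^(v − k − f(E))) placements, v = |V|, of weight p^(e
− |E|), and by `hΦ` their total is O(n^(v − k) p^e/Φ). -/
theorem intersectionBound_edges {n : ℕ} (hn : 0 < n) (x : Fin k ↪ Fin n) {p : ℝ} (h0 : 0 < p)
    {Φ : ℝ} (hΦ0 : 0 < Φ)
    (hΦ : ∀ E ⊆ F.extEdges, E.Nonempty → Φ ≤ (n : ℝ) ^ (F.freeVerts E).ncard * p ^ E.card)
    (L : ℕ) :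
    IntersectionBound p (F.edges (x := x)) L (2 ^ F.extEdges.card * (2 * L + 1) ^ Nat.card V *
      ((n : ℝ) ^ (Nat.card V - k) * p ^ F.extEdges.card / Φ)) := by
  classical
  intro U hU
  set e := F.extEdges.card with he
  have hn' : (0 : ℝ) < n := by exact_mod_cast hn
  calc _ ≤ ∑ φ : F.Reps x, ∑ E ∈ F.extEdges.powerset.filter Finset.Nonempty,
        (if ∀ s ∈ E, Sym2.map φ.1 s ∈ U then (1 : ℝ) else 0) * p ^ (e - E.card) := by
        refine Finset.sum_le_sum fun φ _ => ?_
        have hnn : ∀ E ∈ F.extEdges.powerset.filter Finset.Nonempty,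
            0 ≤ (if ∀ s ∈ E, Sym2.map φ.1 s ∈ U then (1 : ℝ) else 0) * p ^ (e - E.card) :=
          fun E _ => mul_nonneg (by split_ifs <;> norm_num) (by positivity)
        split_ifs with h
        · exact Finset.sum_nonneg hnn
        · refine le_trans (le_of_eq ?_) (Finset.single_le_sum hnn
            (a := F.extEdges.filter fun s => Sym2.map φ.1 s ∈ U) ?_)
          · rw [if_pos fun s hs => (Finset.mem_filter.1 hs).2, one_mul, map_filter_sdiff_card]
          · rw [Finset.mem_filter, Finset.mem_powerset]
            refine ⟨Finset.filter_subset _ _, ?_⟩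
            rw [Finset.not_disjoint_iff] at h
            obtain ⟨t, ht, htU⟩ := h
            obtain ⟨s, hs, rfl⟩ := Finset.mem_map.1 ht
            exact ⟨s, Finset.mem_filter.2 ⟨hs, htU⟩⟩
    _ = ∑ E ∈ F.extEdges.powerset.filter Finset.Nonempty,
        (Nat.card {φ : F.Reps x // ∀ s ∈ E, Sym2.map φ.1 s ∈ U} : ℝ) * p ^ (e - E.card) := by
        rw [Finset.sum_comm]
        refine Finset.sum_congr rfl fun E _ => ?_
        rw [← Finset.sum_mul, Finset.sum_boole, Nat.card_eq_fintype_card, Fintype.card_subtype]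
    _ ≤ ∑ E ∈ F.extEdges.powerset.filter Finset.Nonempty, (2 * (L : ℝ) + 1) ^ Nat.card V *
        ((n : ℝ) ^ (Nat.card V - k) * p ^ e / Φ) := by
        refine Finset.sum_le_sum fun E hE => ?_
        rw [Finset.mem_filter, Finset.mem_powerset] at hE
        have hEe : E.card ≤ e := Finset.card_le_card hE.1
        have hfree := F.ncard_freeVerts_le E
        set f := (F.freeVerts E).ncard with hf
        have h1 : (Nat.card {φ : F.Reps x // ∀ s ∈ E, Sym2.map φ.1 s ∈ U} : ℝ) ≤
            (2 * (L : ℝ) + 1) ^ Nat.card V * (n : ℝ) ^ (Nat.card V - k - f) := by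
          calc _ ≤ ((2 * U.card) ^ f * n ^ (Nat.card V - k - f) : ℝ) := by
                exact_mod_cast F.card_reps_map_mem_le x E U
            _ ≤ _ := by
                refine mul_le_mul_of_nonneg_right ?_ (by positivity)
                have hUL : (U.card : ℝ) ≤ L := by exact_mod_cast hU
                -- The added 1 makes the base at least 1, so that the exponent can be raised to |V|
                -- even when L = 0.
                calc (2 * (U.card : ℝ)) ^ f ≤ (2 * (L : ℝ) + 1) ^ f := by
                      refine pow_le_pow_left₀ (by positivity) (by linarith) _
                  _ ≤ _ := by
                      refine pow_le_pow_right₀ ?_ (by omega)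
                      have : (0 : ℝ) ≤ L := Nat.cast_nonneg _
                      linarith
        refine (mul_le_mul_of_nonneg_right h1 (by positivity)).trans ?_
        rw [mul_assoc]
        refine mul_le_mul_of_nonneg_left ?_ (by positivity)
        rw [le_div_iff₀ hΦ0]
        calc _ ≤ (n : ℝ) ^ (Nat.card V - k - f) * p ^ (e - E.card) * ((n : ℝ) ^ f * p ^ E.card) :=
              mul_le_mul_of_nonneg_left (hΦ E hE.1 hE.2) (by positivity)
          _ = ((n : ℝ) ^ (Nat.card V - k - f) * (n : ℝ) ^ f) * (p ^ (e - E.card) * p ^ E.card) := by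
              ring
          _ = _ := by
              rw [← pow_add, ← pow_add, Nat.sub_add_cancel hEe, Nat.sub_add_cancel (by omega)]
    _ ≤ _ := by
        rw [Finset.sum_const, nsmul_eq_mul, mul_assoc]
        refine mul_le_mul_of_nonneg_right ?_ (by positivity)
        have : (F.extEdges.powerset.filter Finset.Nonempty).card ≤ 2 ^ e := by
          rw [he, ← Finset.card_powerset]
          exact Finset.card_filter_le _ _
        exact_mod_cast this

/-- Only the ψ that agree with φ on the roots and on the vertices of E are counted. There are at
least (n/2)^(v − k − f(E)) of them, and each shares with φ the |E| images of the edges of E. -/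
theorem le_sum_meet_edges {n : ℕ} (hn : 2 * Nat.card V ≤ n) {x : Fin k ↪ Fin n} {p : ℝ}
    (h0 : 0 ≤ p) (h1 : p ≤ 1) (φ : F.Reps x) {E : Finset (Sym2 V)} (hE : E ⊆ F.extEdges)
    (hE' : E.Nonempty) :
    ((n : ℝ) / 2) ^ (Nat.card V - k - (F.freeVerts E).ncard) *
        p ^ (2 * F.extEdges.card - E.card) ≤
      ∑ ψ : F.Reps x, meet (F.edges ψ) (F.edges φ) * p ^ (F.edges φ ∪ F.edges ψ).card := by
  classical
  have hext := le_card_extend hn (Set.range F.root ∪ F.freeVerts E)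
    ((Function.Embedding.subtype _).trans φ.1)
  rw [ncard_union_freeVerts, ← Nat.sub_sub] at hext
  have hinj : Nat.card {ψ : V ↪ Fin n // ∀ t : ↥(Set.range F.root ∪ F.freeVerts E),
      ψ t = ((Function.Embedding.subtype _).trans φ.1) t} ≤
      Nat.card {ψ : F.Reps x // ∀ s ∈ E, Sym2.map ψ.1 s = Sym2.map φ.1 s} := by
    refine Nat.card_le_card_of_injective (fun ψ => ⟨⟨ψ.1, fun j => ?_⟩, fun s hs => ?_⟩)
      fun ψ ψ' h => ?_
    · rw [← φ.2 j]
      exact ψ.2 ⟨F.root j, Or.inl (Set.mem_range_self j)⟩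
    · refine Sym2.map_congr fun v hv => ?_
      by_cases hr : v ∈ Set.range F.root
      · exact ψ.2 ⟨v, Or.inl hr⟩
      · exact ψ.2 ⟨v, Or.inr ⟨hr, s, hs, hv⟩⟩
    · exact Subtype.ext (congrArg (fun χ => χ.1.1) h)
  have hinj' : ((n : ℝ) / 2) ^ (Nat.card V - k - (F.freeVerts E).ncard) ≤
      (Nat.card {ψ : F.Reps x // ∀ s ∈ E, Sym2.map ψ.1 s = Sym2.map φ.1 s} : ℝ) :=
    hext.trans (by exact_mod_cast hinj)
  refine (mul_le_mul_of_nonneg_right hinj' (by positivity)).trans ?_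
  rw [Nat.card_eq_fintype_card, Fintype.card_subtype, ← Finset.sum_boole, Finset.sum_mul]
  refine Finset.sum_le_sum fun ψ _ => ?_
  split_ifs with h
  · have hsub : E.map φ.1.sym2Map ⊆ F.edges φ ∩ F.edges ψ := by
      intro t ht
      obtain ⟨s, hs, rfl⟩ := Finset.mem_map.1 ht
      refine Finset.mem_inter.2 ⟨Finset.mem_map_of_mem _ (hE hs), ?_⟩
      change Sym2.map φ.1 s ∈ _
      rw [← h s hs]
      exact Finset.mem_map_of_mem _ (hE hs)
    have hcard := Finset.card_le_card hsub
    rw [Finset.card_map] at hcard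
    have hmeet : meet (F.edges ψ) (F.edges φ) = 1 := by
      refine if_neg fun hd => ?_
      have : 0 < (F.edges φ ∩ F.edges ψ).card := lt_of_lt_of_le hE'.card_pos hcard
      rw [Finset.card_pos, ← Finset.not_disjoint_iff_nonempty_inter] at this
      exact this hd.symm
    rw [hmeet, one_mul, one_mul]
    refine pow_le_pow_of_le_one h0 h1 ?_
    have := Finset.card_union_add_card_inter (F.edges φ) (F.edges ψ)
    rw [card_edges, card_edges] at this
    omega
  · rw [zero_mul]
    exact mul_nonneg (meet_nonneg _ _) (by positivity)

end RootedGraph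

/-! ### Orders of magnitude of μ and Φ. -/

namespace RootedGraph

variable {k : ℕ} {V : Type*} (F : RootedGraph k V)

theorem extGraph_adj {a b : V} : F.extGraph.Adj a b ↔
    F.graph.Adj a b ∧ ¬ (a ∈ Set.range F.root ∧ b ∈ Set.range F.root) := by
  rw [extGraph, SimpleGraph.deleteEdges_adj, SimpleGraph.Subgraph.mem_edgeSet, rootGraph,
    SimpleGraph.Subgraph.induce_adj, SimpleGraph.Subgraph.top_adj]
  tauto

theorem restrict_extGraph_adj (J : F.graph.Subgraph) (hJ : F.rootGraph ≤ J) {a b : J.verts} :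
    (F.restrict J hJ).extGraph.Adj a b ↔
      J.Adj a b ∧ ¬ ((a : V) ∈ Set.range F.root ∧ (b : V) ∈ Set.range F.root) := by
  have h : ∀ c : J.verts, c ∈ Set.range (F.restrict J hJ).root ↔ (c : V) ∈ Set.range F.root :=
    fun c => ⟨fun ⟨j, hj⟩ => ⟨j, congrArg Subtype.val hj⟩, fun ⟨j, hj⟩ => ⟨j, Subtype.ext hj⟩⟩
  rw [extGraph_adj, h, h]
  rfl

/-- If `J` contains no copy of a tuple, neither does `H`. -/
theorem count_restrict_pos [Finite V] {W : Type*} [Finite W] {Γ : SimpleGraph W} {x : Fin k ↪ W}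
    (J : F.graph.Subgraph) (hJ : F.rootGraph ≤ J) (h : 0 < F.count Γ x) :
    0 < (F.restrict J hJ).count Γ x := by
  have hF := F.card_homs Γ x
  have hR := (F.restrict J hJ).card_homs Γ x
  have hpos : 0 < Nat.card (F.Homs Γ x) := by
    rw [hF]
    exact Nat.mul_pos h F.card_auts_pos
  have hne : Nonempty (F.Homs Γ x) := (Nat.card_pos_iff.1 hpos).1
  obtain ⟨φ⟩ := hne
  have : Nonempty ((F.restrict J hJ).Homs Γ x) := by
    refine ⟨⟨(Function.Embedding.subtype _).trans φ.1, fun j => φ.2.1 j, fun a b hab => ?_⟩⟩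
    rw [restrict_extGraph_adj] at hab
    exact φ.2.2 a b (F.extGraph_adj.2 ⟨J.adj_sub hab.1, hab.2⟩)
  have hpos' : 0 < Nat.card ((F.restrict J hJ).Homs Γ x) := Nat.card_pos
  rw [hR] at hpos'
  exact Nat.pos_of_mul_pos_right hpos'

theorem card_auts_le [Finite V] : Nat.card F.Auts ≤ Nat.card V ^ Nat.card V := by
  rw [← Nat.card_fun]
  exact Nat.card_le_card_of_injective (fun σ : F.Auts => (σ.1 : V → V)) fun _ _ h =>
    Subtype.ext (RelIso.ext fun v => congrFun h v)

theorem mu_nonneg (n : ℕ) (p : unitInterval) : 0 ≤ F.mu n p := by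
  unfold mu expectation
  split_ifs
  · exact integral_nonneg fun _ => Nat.cast_nonneg _
  · exact le_rfl

theorem rootGraph_adj {a b : V} : F.rootGraph.Adj a b ↔
    F.graph.Adj a b ∧ (a ∈ Set.range F.root ∧ b ∈ Set.range F.root) := by
  rw [rootGraph, SimpleGraph.Subgraph.induce_adj, SimpleGraph.Subgraph.top_adj]
  tauto

/-- The subgraph between `G` and `H` that is spanned by `G` and a set of edges of `H_G`. -/
def spanned (E : Finset (Sym2 V)) : F.graph.Subgraph where
  verts := Set.range F.root ∪ F.freeVerts E
  Adj a b := F.graph.Adj a b ∧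
    ((a ∈ Set.range F.root ∧ b ∈ Set.range F.root) ∨ s(a, b) ∈ E)
  adj_sub h := h.1
  edge_vert := by
    rintro a b ⟨hab, h | h⟩
    · exact Or.inl h.1
    · by_cases ha : a ∈ Set.range F.root
      · exact Or.inl ha
      · exact Or.inr ⟨ha, _, h, Sym2.mem_mk_left _ _⟩
  symm := ⟨by
    rintro a b ⟨hab, h⟩
    refine ⟨hab.symm, h.imp And.symm fun h => ?_⟩
    rwa [Sym2.eq_swap]⟩

theorem rootGraph_le_spanned (E : Finset (Sym2 V)) :
    F.rootGraph ≤ F.spanned E := by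
  refine ⟨fun v hv => Or.inl hv, fun a b hab => ?_⟩
  have := F.rootGraph_adj.1 hab
  exact ⟨this.1, Or.inl this.2⟩

section Mu

variable [Finite V]

theorem card_root_le (F : RootedGraph k V) : k ≤ Nat.card V := by
  have := F.ncard_freeVerts_le ∅
  omega

theorem card_auts_mul_mu_le {n : ℕ} (hn : 2 * Nat.card V ≤ n) (p : unitInterval) :
    Nat.card F.Auts * F.mu n p ≤ (n : ℝ) ^ (Nat.card V - k) * (p : ℝ) ^ F.extEdges.card := by
  have hk : k ≤ n := F.card_root_le.trans (by omega)
  rw [← F.expectation_eq_mu n p (Fin.castLEEmb hk), mul_comm, expectation_mul_card_auts]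
  refine mul_le_mul_of_nonneg_right ?_ (pow_nonneg p.2.1 _)
  rw [← Nat.card_eq_fintype_card]
  exact_mod_cast F.card_reps_le _

theorem le_card_auts_mul_mu {n : ℕ} (hn : 2 * Nat.card V ≤ n) (p : unitInterval) :
    ((n : ℝ) / 2) ^ (Nat.card V - k) * (p : ℝ) ^ F.extEdges.card ≤
      Nat.card F.Auts * F.mu n p := by
  have hk : k ≤ n := F.card_root_le.trans (by omega)
  rw [← F.expectation_eq_mu n p (Fin.castLEEmb hk), mul_comm (Nat.card F.Auts : ℝ),
    expectation_mul_card_auts]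
  refine mul_le_mul_of_nonneg_right ?_ (pow_nonneg p.2.1 _)
  rw [← Nat.card_eq_fintype_card]
  exact F.le_card_reps hn _

theorem mu_le {n : ℕ} (hn : 2 * Nat.card V ≤ n) (p : unitInterval) :
    F.mu n p ≤ (n : ℝ) ^ (Nat.card V - k) * (p : ℝ) ^ F.extEdges.card := by
  refine le_trans ?_ (F.card_auts_mul_mu_le hn p)
  have : (1 : ℝ) ≤ Nat.card F.Auts := by exact_mod_cast F.card_auts_pos
  exact le_mul_of_one_le_left (F.mu_nonneg n p) this

theorem pow_le_mu {n : ℕ} (hn : 2 * Nat.card V ≤ n) (p : unitInterval) :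
    (n : ℝ) ^ (Nat.card V - k) * (p : ℝ) ^ F.extEdges.card ≤
      2 ^ Nat.card V * (Nat.card V : ℝ) ^ Nat.card V * F.mu n p := by
  have h := F.le_card_auts_mul_mu hn p
  rw [div_pow, div_mul_eq_mul_div, div_le_iff₀ (by positivity)] at h
  refine h.trans ?_
  have hm := F.mu_nonneg n p
  calc _ ≤ (Nat.card V : ℝ) ^ Nat.card V * F.mu n p * 2 ^ Nat.card V := by
        gcongr
        · exact_mod_cast F.card_auts_le
        · norm_num
        · omega
    _ = _ := by ring

/-- The edges of `J` that are not edges of `G`. -/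
noncomputable def subEdges (J : F.graph.Subgraph) : Finset (Sym2 V) :=
  (Set.toFinite {s | s ∈ F.extGraph.edgeSet ∧ s ∈ J.edgeSet}).toFinset

theorem mem_subEdges {J : F.graph.Subgraph} {s : Sym2 V} :
    s ∈ F.subEdges J ↔ s ∈ F.extGraph.edgeSet ∧ s ∈ J.edgeSet :=
  Set.Finite.mem_toFinset _

theorem subEdges_subset (J : F.graph.Subgraph) : F.subEdges J ⊆ F.extEdges := fun _ hs =>
  F.mem_extEdges.2 (F.mem_subEdges.1 hs).1

theorem card_extEdges_restrict (J : F.graph.Subgraph) (hJ : F.rootGraph ≤ J) :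
    (F.restrict J hJ).extEdges.card = (F.subEdges J).card := by
  rw [← Finset.card_map (Function.Embedding.sym2Map (Function.Embedding.subtype _))]
  congr 1
  ext s
  rw [Finset.mem_map, mem_subEdges]
  constructor
  · rintro ⟨t, ht, rfl⟩
    rw [mem_extEdges] at ht
    induction t with
    | h a b =>
      obtain ⟨h1, h2⟩ := (F.restrict_extGraph_adj J hJ).1 ht
      exact ⟨F.extGraph_adj.2 ⟨J.adj_sub h1, h2⟩, h1⟩
  · rintro ⟨h1, h2⟩
    induction s with
    | h a b =>
      refine ⟨s(⟨a, J.edge_vert h2⟩, ⟨b, J.edge_vert h2.symm⟩), ?_, rfl⟩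
      exact (F.restrict J hJ).mem_extEdges.2
        ((F.restrict_extGraph_adj J hJ).2 ⟨h2, (F.extGraph_adj.1 h1).2⟩)

theorem ncard_edgeSet_lt_iff (J : F.graph.Subgraph) (hJ : F.rootGraph ≤ J) :
    F.rootGraph.edgeSet.ncard < J.edgeSet.ncard ↔ (F.subEdges J).Nonempty := by
  have hsub : F.rootGraph.edgeSet ⊆ J.edgeSet := SimpleGraph.Subgraph.edgeSet_mono hJ
  constructor
  · intro h
    by_contra hne
    refine absurd (Set.ncard_le_ncard (s := J.edgeSet) (t := F.rootGraph.edgeSet) ?_) h.not_ge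
    intro s hs
    induction s with
    | h a b =>
      by_contra hroot
      refine hne ⟨s(a, b), F.mem_subEdges.2 ⟨F.extGraph_adj.2 ⟨J.adj_sub hs, fun hr => ?_⟩, hs⟩⟩
      exact hroot (F.rootGraph_adj.2 ⟨J.adj_sub hs, hr⟩)
  · rintro ⟨s, hs⟩
    rw [mem_subEdges] at hs
    refine Set.ncard_lt_ncard ⟨hsub, fun h => ?_⟩
    have hr := h hs.2
    have he := hs.1
    induction s with
    | h a b => exact (F.extGraph_adj.1 he).2 (F.rootGraph_adj.1 hr).2

/-- The set of values over which the minimum in the definition of `Φ` is taken. -/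
theorem finite_muSet (n : ℕ) (p : unitInterval) :
    {m : ℝ | ∃ (J : F.graph.Subgraph) (hJ : F.rootGraph ≤ J),
      F.rootGraph.edgeSet.ncard < J.edgeSet.ncard ∧ m = (F.restrict J hJ).mu n p}.Finite := by
  have : Finite F.graph.Subgraph := by
    refine Finite.of_injective (fun J : F.graph.Subgraph => (J.verts, J.Adj)) fun J J' h => ?_
    exact SimpleGraph.Subgraph.ext (congrArg Prod.fst h) (congrArg Prod.snd h)
  refine (Set.finite_range fun J : {J : F.graph.Subgraph // F.rootGraph ≤ J} =>
    (F.restrict J.1 J.2).mu n p).subset ?_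
  rintro m ⟨J, hJ, -, rfl⟩
  exact ⟨⟨J, hJ⟩, rfl⟩

theorem Phi_le (n : ℕ) (p : unitInterval) (J : F.graph.Subgraph) (hJ : F.rootGraph ≤ J)
    (h : F.rootGraph.edgeSet.ncard < J.edgeSet.ncard) :
    F.Phi n p ≤ (F.restrict J hJ).mu n p :=
  csInf_le (F.finite_muSet n p).bddBelow ⟨J, hJ, h, rfl⟩

theorem exists_Phi_eq (hF : F.rootGraph.edgeSet.ncard < F.graph.edgeSet.ncard) (n : ℕ)
    (p : unitInterval) : ∃ (J : F.graph.Subgraph) (hJ : F.rootGraph ≤ J),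
      F.rootGraph.edgeSet.ncard < J.edgeSet.ncard ∧ F.Phi n p = (F.restrict J hJ).mu n p :=
  Set.Nonempty.csInf_mem (s := {m : ℝ | ∃ (J : F.graph.Subgraph) (hJ : F.rootGraph ≤ J),
      F.rootGraph.edgeSet.ncard < J.edgeSet.ncard ∧ m = (F.restrict J hJ).mu n p})
    ⟨_, ⊤, le_top, by rwa [SimpleGraph.Subgraph.edgeSet_top], rfl⟩ (F.finite_muSet n p)

theorem subEdges_spanned (E : Finset (Sym2 V)) (hE : E ⊆ F.extEdges) :
    F.subEdges (F.spanned E) = E := by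
  ext s
  rw [mem_subEdges]
  induction s with
  | h a b =>
    constructor
    · rintro ⟨h1, h2, h3⟩
      exact h3.resolve_left (F.extGraph_adj.1 h1).2
    · intro h
      have h1 := F.mem_extEdges.1 (hE h)
      exact ⟨h1, (F.extGraph_adj.1 h1).1, Or.inr h⟩

/-- The subgraph spanned by G and E is a competitor in the minimum Φ. With `exists_pow_le_Phi` this
identifies Φ, up to constants, with a minimum over edge sets. -/
theorem Phi_le_pow {n : ℕ} (hn : 2 * Nat.card V ≤ n) (p : unitInterval) (E : Finset (Sym2 V))
    (hE : E ⊆ F.extEdges) (hE' : E.Nonempty) :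
    F.Phi n p ≤ (n : ℝ) ^ (F.freeVerts E).ncard * (p : ℝ) ^ E.card := by
  set J := F.spanned E
  have hJ : F.rootGraph ≤ J := F.rootGraph_le_spanned E
  have hcard : Nat.card J.verts = k + (F.freeVerts E).ncard := by
    rw [← ncard_union_freeVerts, Nat.card_coe_set_eq]
    rfl
  have hle : Nat.card J.verts ≤ Nat.card V := hcard ▸ F.ncard_freeVerts_le E
  have h := (F.restrict J hJ).mu_le (n := n) (by omega) p
  rw [card_extEdges_restrict, hcard, Nat.add_sub_cancel_left, F.subEdges_spanned E hE] at h
  refine (F.Phi_le n p J hJ ?_).trans h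
  rw [ncard_edgeSet_lt_iff _ _ hJ, F.subEdges_spanned E hE]
  exact hE'

/-- E consists of the edges outside G of a subgraph J that attains Φ. Isolated non-roots of J only
add powers of n to μ_{G,J}, so passing from J to E loses nothing but constants. -/
theorem exists_pow_le_Phi (hF : F.rootGraph.edgeSet.ncard < F.graph.edgeSet.ncard) {n : ℕ}
    (hn : 2 * Nat.card V ≤ n) (hn0 : 0 < n) (p : unitInterval) :
    ∃ E ⊆ F.extEdges, E.Nonempty ∧ (n : ℝ) ^ (F.freeVerts E).ncard * (p : ℝ) ^ E.card ≤
      2 ^ Nat.card V * (Nat.card V : ℝ) ^ Nat.card V * F.Phi n p := by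
  obtain ⟨J, hJ, hlt, hΦ⟩ := F.exists_Phi_eq hF n p
  rw [F.ncard_edgeSet_lt_iff J hJ] at hlt
  refine ⟨F.subEdges J, F.subEdges_subset J, hlt, ?_⟩
  have hV : Nat.card J.verts ≤ Nat.card V := Nat.card_le_card_of_injective _ Subtype.val_injective
  have h := (F.restrict J hJ).pow_le_mu (n := n) (by omega) p
  rw [card_extEdges_restrict, ← hΦ] at h
  have hΦ0 : 0 ≤ F.Phi n p := hΦ ▸ mu_nonneg _ _ _
  have hsub : Set.range F.root ∪ F.freeVerts (F.subEdges J) ⊆ J.verts := by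
    rintro v (⟨j, rfl⟩ | ⟨-, s, hs, hv⟩)
    · exact hJ.1 (Set.mem_range_self j)
    · exact J.mem_verts_of_mem_edge (F.mem_subEdges.1 hs).2 hv
  have hfree : (F.freeVerts (F.subEdges J)).ncard ≤ Nat.card J.verts - k := by
    have := Set.ncard_le_ncard hsub
    rw [ncard_union_freeVerts] at this
    rw [Nat.card_coe_set_eq]
    omega
  have hVpos : 0 < Nat.card V := by
    obtain ⟨s, -⟩ := hlt
    have : Nonempty V := by
      induction s with
      | h a b => exact ⟨a⟩
    exact Nat.card_pos
  have hn1 : (1 : ℝ) ≤ n := by exact_mod_cast hn0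
  have hV1 : (1 : ℝ) ≤ Nat.card V := by exact_mod_cast hVpos
  calc _ ≤ (n : ℝ) ^ (Nat.card J.verts - k) * (p : ℝ) ^ (F.subEdges J).card := by
        refine mul_le_mul_of_nonneg_right (pow_le_pow_right₀ hn1 hfree) (pow_nonneg p.2.1 _)
    _ ≤ _ := h
    _ ≤ _ := by
        refine mul_le_mul_of_nonneg_right ?_ hΦ0
        refine mul_le_mul (pow_le_pow_right₀ (by norm_num) hV) ?_ (by positivity) (by positivity)
        calc ((Nat.card J.verts : ℕ) : ℝ) ^ Nat.card J.verts ≤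
            (Nat.card V : ℝ) ^ Nat.card J.verts := by
              gcongr
          _ ≤ _ := pow_le_pow_right₀ hV1 hV

end Mu

end RootedGraph

/-! ### From single tuples to the maximum, and the value of D for placements. -/

theorem IntersectionBound.mono {α ι : Type*} [DecidableEq α] [Fintype ι] {p : ℝ}
    {A : ι → Finset α} {L : ℕ} {D D' : ℝ} (h : IntersectionBound p A L D) (hD : D ≤ D') :
    IntersectionBound p A L D' :=
  fun U hU => (h U hU).trans hD

theorem real_setOf_le_of_imp {n : ℕ} (p : unitInterval) {P Q : SimpleGraph (Fin n) → Prop}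
    (h : ∀ Γ, P Γ → Q Γ) : (SimpleGraph.binomialRandom (Fin n) p).real {Γ | P Γ} ≤
      (SimpleGraph.binomialRandom (Fin n) p).real {Γ | Q Γ} :=
  measureReal_mono h

theorem one_sub_real_setOf {n : ℕ} (p : unitInterval) (P : SimpleGraph (Fin n) → Prop) :
    1 - (SimpleGraph.binomialRandom (Fin n) p).real {Γ | P Γ} =
      (SimpleGraph.binomialRandom (Fin n) p).real {Γ | ¬ P Γ} :=
  (probReal_compl_eq_one_sub (measurableSet_simpleGraph {Γ | P Γ})).symm

theorem tendsto_one_of_forall_eventually_le {q : ℕ → ℝ} (h1 : ∀ n, q n ≤ 1)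
    (h : ∀ η > 0, ∀ᶠ n in atTop, 1 - η ≤ q n) : Tendsto q atTop (𝓝 1) := by
  rw [Metric.tendsto_atTop']
  intro η hη
  obtain ⟨N, hN⟩ := eventually_atTop.1 (h (η / 2) (by positivity))
  refine ⟨N, fun n hn => ?_⟩
  rw [Real.dist_eq, abs_lt]
  have := hN n hn.le
  have := h1 n
  constructor <;> linarith

namespace RootedGraph

variable {k : ℕ} {V : Type*} (F : RootedGraph k V)

theorem one_sub_le_real_le_maxDeviation {n : ℕ} (p : unitInterval) (x : Fin k ↪ Fin n) (t : ℝ) :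
    1 - (SimpleGraph.binomialRandom (Fin n) p).real {Γ | |(F.count Γ x : ℝ) - F.mu n p| < t} ≤
      (SimpleGraph.binomialRandom (Fin n) p).real {Γ | t ≤ F.maxDeviation n p Γ} := by
  rw [one_sub_real_setOf]
  refine real_setOf_le_of_imp p fun Γ hΓ => (not_lt.1 hΓ).trans ?_
  exact le_ciSup (f := fun x : Fin k ↪ Fin n => |(F.count Γ x : ℝ) - F.mu n p|)
    (Set.finite_range _).bddAbove x

theorem one_sub_real_maxDeviation_lt_le {n : ℕ} (hk : k ≤ n) (p : unitInterval) {t b : ℝ}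
    (h : ∀ x : Fin k ↪ Fin n, (SimpleGraph.binomialRandom (Fin n) p).real
      {Γ | t ≤ |(F.count Γ x : ℝ) - F.mu n p|} ≤ b) :
    1 - (SimpleGraph.binomialRandom (Fin n) p).real {Γ | F.maxDeviation n p Γ < t} ≤
      (n : ℝ) ^ k * b := by
  have hne : Nonempty (Fin k ↪ Fin n) := ⟨Fin.castLEEmb hk⟩
  have hb : 0 ≤ b := measureReal_nonneg.trans (h hne.some)
  rw [one_sub_real_setOf]
  calc _ ≤ (SimpleGraph.binomialRandom (Fin n) p).real
        (⋃ x ∈ (Finset.univ : Finset (Fin k ↪ Fin n)),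
          {Γ | t ≤ |(F.count Γ x : ℝ) - F.mu n p|}) := by
        refine measureReal_mono (fun Γ hΓ => ?_) (measure_ne_top _ _)
        obtain ⟨x, hx⟩ := exists_eq_ciSup_of_finite
          (f := fun x : Fin k ↪ Fin n => |(F.count Γ x : ℝ) - F.mu n p|)
        refine Set.mem_biUnion (Finset.mem_univ x) ?_
        change t ≤ |(F.count Γ x : ℝ) - F.mu n p|
        rw [hx]
        exact not_lt.1 hΓ
    _ ≤ ∑ x : Fin k ↪ Fin n, (SimpleGraph.binomialRandom (Fin n) p).real
        {Γ | t ≤ |(F.count Γ x : ℝ) - F.mu n p|} := measureReal_biUnion_finset_le _ _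
    _ ≤ ∑ _x : Fin k ↪ Fin n, b := Finset.sum_le_sum fun x _ => h x
    _ ≤ _ := by
        rw [Finset.sum_const, nsmul_eq_mul, Finset.card_univ, Fintype.card_embedding_eq,
          Fintype.card_fin, Fintype.card_fin]
        refine mul_le_mul_of_nonneg_right ?_ hb
        exact_mod_cast Nat.descFactorial_le_pow n k

variable [Finite V]

theorem extEdges_nonempty (hF : F.rootGraph.edgeSet.ncard < F.graph.edgeSet.ncard) :
    F.extEdges.Nonempty := by
  have h := (F.ncard_edgeSet_lt_iff ⊤ le_top).1 (by rwa [SimpleGraph.Subgraph.edgeSet_top])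
  exact h.mono (F.subEdges_subset ⊤)

theorem pos_of_Phi_pos (hF : F.rootGraph.edgeSet.ncard < F.graph.edgeSet.ncard) {n : ℕ}
    (hn : 2 * Nat.card V ≤ n) {p : unitInterval} (hΦ : 0 < F.Phi n p) : (0 : ℝ) < p := by
  refine lt_of_le_of_ne p.2.1 fun h => ?_
  have hne := F.extEdges_nonempty hF
  have := F.Phi_le_pow hn p F.extEdges subset_rfl hne
  rw [← h, zero_pow hne.card_pos.ne', mul_zero] at this
  linarith

theorem mu_pos_of_Phi_pos (hF : F.rootGraph.edgeSet.ncard < F.graph.edgeSet.ncard) {n : ℕ}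
    (hn : 2 * Nat.card V ≤ n) (hn0 : 0 < n) {p : unitInterval} (hΦ : 0 < F.Phi n p) :
    0 < F.mu n p := by
  have hp := F.pos_of_Phi_pos hF hn hΦ
  refine lt_of_le_of_ne (F.mu_nonneg n p) fun h => ?_
  have := F.pow_le_mu hn p
  rw [← h, mul_zero] at this
  have hn' : (0 : ℝ) < n := by exact_mod_cast hn0
  have : 0 < (n : ℝ) ^ (Nat.card V - k) * (p : ℝ) ^ F.extEdges.card := by positivity
  linarith

/-- The constant in the bounds for the number of intersecting copies. -/
noncomputable def interConst (L : ℕ) : ℝ :=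
  2 ^ F.extEdges.card * (2 * L + 1) ^ Nat.card V * (2 ^ Nat.card V * Nat.card V ^ Nat.card V)

theorem interConst_nonneg (L : ℕ) : 0 ≤ F.interConst L := by
  unfold interConst
  positivity

theorem intersectionBound (hF : F.rootGraph.edgeSet.ncard < F.graph.edgeSet.ncard) {n : ℕ}
    (hn : 2 * Nat.card V ≤ n) (hn0 : 0 < n) {p : unitInterval} (hΦ : 0 < F.Phi n p)
    (x : Fin k ↪ Fin n) (L : ℕ) :
    IntersectionBound (p : ℝ) (F.edges (x := x)) L (F.interConst L * (F.mu n p / F.Phi n p)) := by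
  have hp := F.pos_of_Phi_pos hF hn hΦ
  refine (F.intersectionBound_edges hn0 x hp hΦ (F.Phi_le_pow hn p) L).mono ?_
  unfold interConst
  rw [mul_assoc (2 ^ F.extEdges.card * (2 * (L : ℝ) + 1) ^ Nat.card V)]
  refine mul_le_mul_of_nonneg_left ?_ (by positivity)
  rw [← mul_div_assoc]
  exact div_le_div_of_nonneg_right (F.pow_le_mu hn p) hΦ.le

/-! ### Concentration of all counts. -/

/-- Tail bound for a single tuple that follows from the moments of order `2 * m`. -/
theorem exists_tail_le (hF : F.rootGraph.edgeSet.ncard < F.graph.edgeSet.ncard) (m : ℕ) {c : ℝ}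
    (hc : 0 < c) : ∃ C : ℝ, 0 ≤ C ∧ ∀ (n : ℕ) (p : unitInterval) (x : Fin k ↪ Fin n) (t : ℝ),
      2 * Nat.card V ≤ n → 0 < n → c ≤ F.Phi n p → 0 < t →
      (SimpleGraph.binomialRandom (Fin n) p).real {Γ | t ≤ |(F.count Γ x : ℝ) - F.mu n p|} ≤
        C * (((t / F.mu n p) ^ 2 * F.Phi n p)⁻¹) ^ m := by
  classical
  set K := F.interConst (F.extEdges.card * (2 * m)) with hK
  set a : ℝ := ((Nat.card F.Auts : ℕ) : ℝ) with ha
  have hK0 : 0 ≤ K := F.interConst_nonneg _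
  have ha1 : 1 ≤ a := by
    rw [ha]
    exact_mod_cast F.card_auts_pos
  refine ⟨(16 * ((a + K / c) * K)) ^ m, by positivity, fun n p x t hn hn0 hΦc ht => ?_⟩
  have hΦ : 0 < F.Phi n p := hc.trans_le hΦc
  have hμ := F.mu_pos_of_Phi_pos hF hn hn0 hΦ
  have hmom := bern_sum_cen_pow_le p.2.1 p.2.2 (F.edges_subset (x := x))
    (fun φ => (F.card_edges φ).le) (F.intersectionBound hF hn hn0 hΦ x _) m le_rfl
  rw [sum_pow_card_edges, ← ha, ← hK] at hmom
  simp only [← card_auts_mul_count_sub_mu, ← ha] at hmom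
  set μ := F.mu n p with hμdef
  set Φ := F.Phi n p with hΦdef
  rw [binomialRandom_real_setOf]
  calc _ ≤ bern p (edgeSlots n) (fun B => ((t ^ 2) ^ m)⁻¹ *
        (a * ((F.count (SimpleGraph.fromEdgeSet (B : Set (Sym2 (Fin n)))) x : ℝ) - μ)) ^
          (2 * m)) := by
        refine bern_mono p.2.1 p.2.2 _ fun B _ => ?_
        split_ifs with h
        · rw [pow_mul, ← inv_pow, ← mul_pow]
          refine one_le_pow₀ ?_
          rw [← div_eq_inv_mul, one_le_div (by positivity), mul_pow]
          have h2 : t ^ 2 ≤ ((F.count (SimpleGraph.fromEdgeSet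
              (B : Set (Sym2 (Fin n)))) x : ℝ) - μ) ^ 2 := by
            rw [← sq_abs (_ - μ)]
            gcongr
          exact h2.trans (le_mul_of_one_le_left (sq_nonneg _) (one_le_pow₀ ha1))
        · rw [pow_mul]
          positivity
    _ ≤ ((t ^ 2) ^ m)⁻¹ * (16 ^ m * ((a * μ + K * (μ / Φ)) * (K * (μ / Φ))) ^ m) := by
        rw [bern_const_mul]
        exact mul_le_mul_of_nonneg_left hmom (by positivity)
    -- Here Φ ≥ c enters: D = Kμ/Φ is at most a constant times μ.
    _ ≤ ((t ^ 2) ^ m)⁻¹ * (16 ^ m * (((a + K / c) * μ) * (K * (μ / Φ))) ^ m) := by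
        have : K * (μ / Φ) ≤ K / c * μ := by
          rw [mul_div_assoc', div_mul_eq_mul_div]
          exact div_le_div_of_nonneg_left (by positivity) hc hΦc
        gcongr
        rw [add_mul]
        linarith
    _ = _ := by
        rw [← inv_pow, ← mul_pow, ← mul_pow, ← mul_pow]
        congr 1
        field_simp

/-- With very high probability, all counts are close to the mean. -/
theorem isLittleO_one_sub_real_maxDeviation_lt
    (hF : F.rootGraph.edgeSet.ncard < F.graph.edgeSet.ncard) (p : ℕ → unitInterval) (t : ℕ → ℝ)
    (ht : ∀ n, 0 ≤ t n) (hΦ : ∃ c : ℝ, 0 < c ∧ ∀ᶠ n : ℕ in atTop, c ≤ F.Phi n (p n))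
    (htΦ : ∃ c : ℝ, 0 < c ∧ ∀ᶠ n : ℕ in atTop,
      (n : ℝ) ^ c ≤ (t n / F.mu n (p n)) ^ 2 * F.Phi n (p n)) (τ : ℝ) :
    (fun n : ℕ => 1 - (SimpleGraph.binomialRandom (Fin n) (p n)).real
      {Γ | F.maxDeviation n (p n) Γ < t n}) =o[atTop] (fun n : ℕ => (n : ℝ) ^ (-τ)) := by
  obtain ⟨c, hc, hΦ⟩ := hΦ
  obtain ⟨c', hc', htΦ⟩ := htΦ
  -- The tail is O(n^(-c'm)). The exponent k pays for the union bound, and the extra 1 turns the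
  -- final O(n^(-τ-1)) into o(n^(-τ)).
  obtain ⟨m, hm⟩ := exists_nat_ge ((k + τ + 1) / c')
  rw [div_le_iff₀ hc'] at hm
  obtain ⟨C, hC, htail⟩ := F.exists_tail_le hF m hc
  have hO : (fun n : ℕ => 1 - (SimpleGraph.binomialRandom (Fin n) (p n)).real
      {Γ | F.maxDeviation n (p n) Γ < t n}) =O[atTop] (fun n : ℕ => (n : ℝ) ^ (-(τ + 1))) := by
    refine Asymptotics.IsBigO.of_bound C ?_
    filter_upwards [hΦ, htΦ, eventually_ge_atTop (2 * Nat.card V), eventually_gt_atTop 0]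
      with n h1 h2 hn hn0
    have hn' : (0 : ℝ) < n := by exact_mod_cast hn0
    have hn1 : (1 : ℝ) ≤ n := by exact_mod_cast hn0
    have hkn : k ≤ n := F.card_root_le.trans (by omega)
    have hpos : 0 < (n : ℝ) ^ c' := Real.rpow_pos_of_pos hn' _
    have htpos : 0 < t n := by
      refine lt_of_le_of_ne (ht n) fun h => ?_
      rw [← h] at h2
      simp only [zero_div, ne_eq, OfNat.ofNat_ne_zero, not_false_eq_true, zero_pow, zero_mul] at h2
      linarith
    have hb := F.one_sub_real_maxDeviation_lt_le hkn (p n) fun x =>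
      htail n (p n) x (t n) hn hn0 h1 htpos
    have hnn : 0 ≤ 1 - (SimpleGraph.binomialRandom (Fin n) (p n)).real
        {Γ | F.maxDeviation n (p n) Γ < t n} := by
      rw [one_sub_real_setOf]
      exact measureReal_nonneg
    rw [Real.norm_of_nonneg hnn, Real.norm_of_nonneg (Real.rpow_nonneg hn'.le _)]
    refine hb.trans ?_
    rw [mul_left_comm]
    refine mul_le_mul_of_nonneg_left ?_ hC
    have hinv : 0 ≤ ((t n / F.mu n (p n)) ^ 2 * F.Phi n (p n))⁻¹ :=
      inv_nonneg.2 (hpos.le.trans h2)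
    calc _ ≤ (n : ℝ) ^ k * (((n : ℝ) ^ c')⁻¹) ^ m := by gcongr
      _ = (n : ℝ) ^ ((k : ℝ) - c' * m) := by
          rw [Real.rpow_sub hn', Real.rpow_natCast, Real.rpow_mul hn'.le, Real.rpow_natCast,
            inv_pow, div_eq_mul_inv]
      _ ≤ _ := Real.rpow_le_rpow_of_exponent_le hn1 (by linarith)
  refine hO.trans_isLittleO ?_
  have hlim : Tendsto (fun n : ℕ => (n : ℝ) ^ (-(1 : ℝ))) atTop (𝓝 0) :=
    (tendsto_rpow_neg_atTop zero_lt_one).comp tendsto_natCast_atTop_atTop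
  refine Asymptotics.isLittleO_of_tendsto' ?_ (hlim.congr' ?_)
  · filter_upwards [eventually_gt_atTop 0] with n hn0 h
    have hn' : (0 : ℝ) < n := by exact_mod_cast hn0
    exact absurd h (Real.rpow_pos_of_pos hn' _).ne'
  · filter_upwards [eventually_gt_atTop 0] with n hn0
    have hn' : (0 : ℝ) < n := by exact_mod_cast hn0
    rw [← Real.rpow_sub hn']
    congr 1
    ring

/-! ### Large deviations of a single count. -/

/-- An extension by H contains one by the J that attains Φ, so Markov's inequality for J applies. -/
theorem real_count_pos_le_Phi (hF : F.rootGraph.edgeSet.ncard < F.graph.edgeSet.ncard) {n : ℕ}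
    (p : unitInterval) (x : Fin k ↪ Fin n) :
    (SimpleGraph.binomialRandom (Fin n) p).real {Γ | 0 < F.count Γ x} ≤ F.Phi n p := by
  classical
  obtain ⟨J, hJ, -, hΦ⟩ := F.exists_Phi_eq hF n p
  rw [hΦ, ← expectation_eq_mu _ n p x, expectation, integral_binomialRandom,
    binomialRandom_real_setOf]
  refine bern_mono p.2.1 p.2.2 _ fun B _ => ?_
  split_ifs with h
  · exact_mod_cast F.count_restrict_pos J hJ h
  · exact Nat.cast_nonneg _

theorem tendsto_real_le_maxDeviation_of_Phi_tendsto_zero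
    (hF : F.rootGraph.edgeSet.ncard < F.graph.edgeSet.ncard) (p : ℕ → unitInterval) (ε : ℕ → ℝ)
    (hε : ∀ n, ε n ≤ 1) (hΦ : Tendsto (fun n : ℕ => F.Phi n (p n)) atTop (𝓝 0)) :
    Tendsto (fun n : ℕ => (SimpleGraph.binomialRandom (Fin n) (p n)).real
      {Γ | ε n * F.mu n (p n) ≤ F.maxDeviation n (p n) Γ}) atTop (𝓝 1) := by
  refine tendsto_one_of_forall_eventually_le (fun n => measureReal_le_one) fun η hη => ?_
  filter_upwards [hΦ.eventually_le_const hη, eventually_ge_atTop k] with n hn hk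
  refine le_trans ?_ (F.one_sub_le_real_le_maxDeviation (p n) (Fin.castLEEmb hk) _)
  refine sub_le_sub_left (le_trans ?_ ((F.real_count_pos_le_Phi hF (p n) (Fin.castLEEmb hk)).trans hn)) 1
  refine real_setOf_le_of_imp (p n) fun Γ hΓ => Nat.pos_of_ne_zero fun h0 => ?_
  rw [h0, Nat.cast_zero, zero_sub, abs_neg, abs_of_nonneg (F.mu_nonneg n (p n))] at hΓ
  have := mul_le_of_le_one_left (F.mu_nonneg n (p n)) (hε n)
  linarith

/-- Lower bound for the variance. -/
theorem le_variance (hF : F.rootGraph.edgeSet.ncard < F.graph.edgeSet.ncard) {n : ℕ}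
    (hn : 2 * Nat.card V ≤ n) (hn0 : 0 < n) {p : unitInterval} (hΦ : 0 < F.Phi n p)
    (x : Fin k ↪ Fin n) :
    (1 - (p : ℝ)) * F.mu n p ^ 2 / F.Phi n p ≤
      4 ^ Nat.card V * (Nat.card V : ℝ) ^ Nat.card V *
        bern p (edgeSlots n) (fun B => (∑ φ : F.Reps x, cen p (F.edges φ) B) ^ 2) := by
  have hp := F.pos_of_Phi_pos hF hn hΦ
  have hp1 : 0 ≤ 1 - (p : ℝ) := sub_nonneg.2 p.2.2
  have hn' : (0 : ℝ) < n := by exact_mod_cast hn0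
  have hμ := F.mu_nonneg n p
  obtain ⟨E, hE, hE', hEΦ⟩ := F.exists_pow_le_Phi hF hn hn0 p
  set e := F.extEdges.card with he
  set f := (F.freeVerts E).ncard with hf
  set v := Nat.card V with hv
  have hEe : E.card ≤ e := Finset.card_le_card hE
  have hfree : k + f ≤ v := F.ncard_freeVerts_le E
  -- For the near-optimal E, μ/Φ is up to constants the expected number of further copies that
  -- contain the image of E, given one copy. One 2^v comes from replacing n by n/2, the other from
  -- `exists_pow_le_Phi`.
  have hkey : F.mu n p / F.Phi n p ≤ 4 ^ v * (v : ℝ) ^ v *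
      (((n : ℝ) / 2) ^ (v - k - f) * (p : ℝ) ^ (e - E.card)) := by
    rw [div_le_iff₀ hΦ]
    calc F.mu n p ≤ (n : ℝ) ^ (v - k) * (p : ℝ) ^ e := F.mu_le hn p
      _ = (n : ℝ) ^ (v - k - f) * (p : ℝ) ^ (e - E.card) * ((n : ℝ) ^ f * (p : ℝ) ^ E.card) := by
          rw [mul_mul_mul_comm, ← pow_add, ← pow_add, Nat.sub_add_cancel hEe,
            Nat.sub_add_cancel (by omega)]
      _ ≤ (2 ^ v * ((n : ℝ) / 2) ^ (v - k - f)) * (p : ℝ) ^ (e - E.card) *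
          (2 ^ v * (v : ℝ) ^ v * F.Phi n p) := by
          refine mul_le_mul (mul_le_mul_of_nonneg_right ?_ (by positivity)) hEΦ (by positivity)
            (by positivity)
          rw [div_pow, mul_div_assoc', le_div_iff₀ (by positivity), mul_comm]
          refine mul_le_mul_of_nonneg_right ?_ (by positivity)
          exact pow_le_pow_right₀ (by norm_num) (by omega)
      _ = _ := by
          rw [show (4 : ℝ) = 2 * 2 by norm_num, mul_pow]
          ring
  have hμR : F.mu n p ≤ (Fintype.card (F.Reps x) : ℝ) * (p : ℝ) ^ e := by
    have h1 := F.sum_pow_card_edges p x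
    simp only [card_edges, Finset.sum_const, Finset.card_univ, nsmul_eq_mul] at h1
    rw [h1]
    have : (1 : ℝ) ≤ Nat.card F.Auts := by exact_mod_cast F.card_auts_pos
    exact le_mul_of_one_le_left hμ this
  have hvar := le_bern_sq_sum_cen p.2.1 p.2.2 (F.edges_subset (x := x))
  have hsum : (Fintype.card (F.Reps x) : ℝ) *
      (((n : ℝ) / 2) ^ (v - k - f) * (p : ℝ) ^ (2 * e - E.card)) ≤
      ∑ φ : F.Reps x, ∑ ψ : F.Reps x, meet (F.edges ψ) (F.edges φ) *
        (p : ℝ) ^ (F.edges φ ∪ F.edges ψ).card := by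
    rw [← nsmul_eq_mul, ← Finset.card_univ, ← Finset.sum_const]
    exact Finset.sum_le_sum fun φ _ => F.le_sum_meet_edges hn p.2.1 p.2.2 φ hE hE'
  calc (1 - (p : ℝ)) * F.mu n p ^ 2 / F.Phi n p =
        (1 - (p : ℝ)) * (F.mu n p * (F.mu n p / F.Phi n p)) := by ring
    _ ≤ (1 - (p : ℝ)) * (((Fintype.card (F.Reps x) : ℝ) * (p : ℝ) ^ e) * (4 ^ v * (v : ℝ) ^ v *
        (((n : ℝ) / 2) ^ (v - k - f) * (p : ℝ) ^ (e - E.card)))) := by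
        refine mul_le_mul_of_nonneg_left ?_ hp1
        exact mul_le_mul hμR hkey (div_nonneg hμ hΦ.le) (by positivity)
    _ = 4 ^ v * (v : ℝ) ^ v * ((1 - (p : ℝ)) * ((Fintype.card (F.Reps x) : ℝ) *
        (((n : ℝ) / 2) ^ (v - k - f) * (p : ℝ) ^ (2 * e - E.card)))) := by
        rw [show 2 * e - E.card = e + (e - E.card) by omega, pow_add]
        ring
    _ ≤ _ := by
        refine mul_le_mul_of_nonneg_left (le_trans ?_ hvar) (by positivity)
        exact mul_le_mul_of_nonneg_left hsum hp1

/-- Anti-concentration of the count for a single tuple. -/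
theorem exists_real_abs_sub_lt_le (hF : F.rootGraph.edgeSet.ncard < F.graph.edgeSet.ncard) :
    ∃ c : ℝ, 0 < c ∧ ∃ C : ℝ, ∀ (n : ℕ) (p : unitInterval) (x : Fin k ↪ Fin n) (ε δ : ℝ),
      2 * Nat.card V ≤ n → 0 < n → 0 < F.Phi n p → (p : ℝ) < 1 → 0 < ε → 0 < δ →
      ε ^ 2 * F.Phi n p / (1 - (p : ℝ)) ≤ c * δ ^ 2 →
      (SimpleGraph.binomialRandom (Fin n) p).real
        {Γ | |(F.count Γ x : ℝ) - F.mu n p| < ε * F.mu n p} ≤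
        4 * δ + C / δ / √(F.Phi n p * (1 - (p : ℝ))) := by
  classical
  set e := F.extEdges.card with he
  set a : ℝ := ((Nat.card F.Auts : ℕ) : ℝ) with ha
  set K := F.interConst (2 * e) with hK
  have ha1 : 1 ≤ a := by
    rw [ha]
    exact_mod_cast F.card_auts_pos
  have hVpos : 0 < Nat.card V := by
    obtain ⟨s, -⟩ := F.extEdges_nonempty hF
    have : Nonempty V := by
      induction s with
      | h a b => exact ⟨a⟩
    exact Nat.card_pos
  have hVpos' : (0 : ℝ) < Nat.card V := by exact_mod_cast hVpos
  set b : ℝ := 4 ^ Nat.card V * (Nat.card V : ℝ) ^ Nat.card V with hb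
  have hb0 : 0 < b := by positivity
  have hsb : 0 < √b := Real.sqrt_pos.2 hb0
  -- The first constant is what makes aεμ ≤ δr below, with r the lower bound for the standard
  -- deviation; the second collects the Stein error with M = aμ, D = Kμ/Φ and r in place of s.
  refine ⟨1 / (b * a ^ 2), by positivity,
    6 * (16 + 2 * e * 8 ^ e) * a * K ^ 2 * √b ^ 3, fun n p x ε δ hn hn0 hΦ hp1 hε hδ hεδ => ?_⟩
  have hμ := F.mu_pos_of_Phi_pos hF hn hn0 hΦ
  have hp1' : 0 < 1 - (p : ℝ) := sub_pos.2 hp1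
  have hvar := F.le_variance hF hn hn0 hΦ x
  rw [← hb] at hvar
  have hID := F.intersectionBound hF hn hn0 hΦ x (2 * e)
  rw [← hK] at hID
  set μ := F.mu n p with hμdef
  set Φ := F.Phi n p with hΦdef
  set Var := bern p (edgeSlots n) (fun B => (∑ φ : F.Reps x, cen p (F.edges φ) B) ^ 2) with hVar
  set y := √(Φ * (1 - (p : ℝ))) with hy
  have hy0 : 0 < y := Real.sqrt_pos.2 (by positivity)
  have hysq : y ^ 2 = Φ * (1 - (p : ℝ)) := Real.sq_sqrt (by positivity)
  -- Chosen so that r² = (1 − p)μ²/(Φb), the lower bound for the variance.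
  set r := μ * y / (Φ * √b) with hr
  have hr0 : 0 < r := by positivity
  have hrsq : r ^ 2 ≤ Var := by
    have : r ^ 2 = (1 - (p : ℝ)) * μ ^ 2 / Φ / b := by
      rw [hr, div_pow, mul_pow, mul_pow, hysq, Real.sq_sqrt hb0.le]
      field_simp
    rw [this, div_le_iff₀ hb0, mul_comm Var]
    exact hvar
  have hVar0 : 0 < Var := lt_of_lt_of_le (by positivity) hrsq
  set s := √Var with hs
  have hs0 : 0 < s := Real.sqrt_pos.2 hVar0
  have hrs : r ≤ s := Real.le_sqrt_of_sq_le hrsq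
  have hball := bern_small_ball_le p.2.1 p.2.2 (F.edges_subset (x := x))
    (fun φ => (F.card_edges φ).le) le_rfl hID hs0 (Real.sq_sqrt hVar0.le).symm hδ
  rw [sum_pow_card_edges, ← ha, ← he] at hball
  have hεr : a * (ε * μ) ≤ δ * s := by
    refine le_trans ?_ (mul_le_mul_of_nonneg_left hrs hδ.le)
    refine (sq_le_sq₀ (by positivity) (by positivity)).1 ?_
    rw [mul_pow, mul_pow, mul_pow, hr, div_pow, mul_pow, mul_pow, hysq, Real.sq_sqrt hb0.le]
    rw [div_le_iff₀ hp1', one_div, inv_mul_eq_div, div_mul_eq_mul_div,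
      le_div_iff₀ (by positivity)] at hεδ
    rw [mul_div_assoc', le_div_iff₀ (by positivity)]
    have : 0 ≤ μ ^ 2 * Φ := by positivity
    nlinarith [mul_le_mul_of_nonneg_left hεδ this]
  calc _ ≤ bern p (edgeSlots n) (fun B =>
        if |∑ φ : F.Reps x, cen p (F.edges φ) B| ≤ δ * s then 1 else 0) := by
        rw [binomialRandom_real_setOf]
        refine bern_mono p.2.1 p.2.2 _ fun B _ => ?_
        rw [← card_auts_mul_count_sub_mu, abs_mul, Nat.abs_cast, ← ha]
        split_ifs with h1 h2 h2
        · exact le_rfl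
        · refine absurd (le_trans ?_ hεr) h2
          exact mul_le_mul_of_nonneg_left h1.le (by positivity)
        · norm_num
        · exact le_rfl
    _ ≤ _ := hball
    _ ≤ 4 * δ + 6 / δ * ((16 + 2 * e * 8 ^ e) * (1 - (p : ℝ))) *
        (a * μ * (K * (μ / Φ)) ^ 2) / r ^ 3 := by
        have : 0 ≤ a * μ * (K * (μ / Φ)) ^ 2 := by positivity
        gcongr
    _ = _ := by
        congr 1
        have h1 : (1 - (p : ℝ)) = y ^ 2 / Φ := by
          rw [hysq]
          field_simp
        rw [h1, hr]
        field_simp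

theorem tendsto_real_le_maxDeviation_of_tendsto_atTop
    (hF : F.rootGraph.edgeSet.ncard < F.graph.edgeSet.ncard) (p : ℕ → unitInterval) (ε : ℕ → ℝ)
    (hε : ∀ n, 0 < ε n)
    (hΦ : Tendsto (fun n : ℕ => F.Phi n (p n) * (1 - (p n : ℝ))) atTop atTop)
    (hεΦ : Tendsto (fun n : ℕ => ε n ^ 2 * F.Phi n (p n) / (1 - (p n : ℝ))) atTop (𝓝 0)) :
    Tendsto (fun n : ℕ => (SimpleGraph.binomialRandom (Fin n) (p n)).real
      {Γ | ε n * F.mu n (p n) ≤ F.maxDeviation n (p n) Γ}) atTop (𝓝 1) := by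
  obtain ⟨c, hc, C, h⟩ := F.exists_real_abs_sub_lt_le hF
  refine tendsto_one_of_forall_eventually_le (fun n => measureReal_le_one) fun η hη => ?_
  -- With δ = η/8 the term 4δ is η/2, which leaves η/2 for the Stein error.
  have hδ : 0 < η / 8 := by positivity
  have hlim : Tendsto (fun n : ℕ => C / (η / 8) / √(F.Phi n (p n) * (1 - (p n : ℝ)))) atTop
      (𝓝 0) := (Real.tendsto_sqrt_atTop.comp hΦ).const_div_atTop _
  filter_upwards [hlim.eventually_le_const (show 0 < η / 2 by positivity),
    hΦ.eventually_gt_atTop 0, eventually_ge_atTop (2 * Nat.card V), eventually_gt_atTop 0,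
    hεΦ.eventually_le_const (show 0 < c * (η / 8) ^ 2 by positivity)] with n h1 h2 hn hn0 h3
  have hp1 : (p n : ℝ) < 1 := by
    refine lt_of_le_of_ne (p n).2.2 fun h => ?_
    rw [h, sub_self, mul_zero] at h2
    exact lt_irrefl _ h2
  have hΦ0 : 0 < F.Phi n (p n) := pos_of_mul_pos_left h2 (sub_nonneg.2 hp1.le)
  have hk : k ≤ n := F.card_root_le.trans (by omega)
  have := h n (p n) (Fin.castLEEmb hk) (ε n) (η / 8) hn hn0 hΦ0 hp1 (hε n) hδ h3
  have := F.one_sub_le_real_le_maxDeviation (p n) (Fin.castLEEmb hk) (ε n * F.mu n (p n))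
  linarith

end RootedGraph

theorem theorem5 {k : ℕ} {V : Type*} [Finite V] (F : RootedGraph k V)
    (hF : F.rootGraph.edgeSet.ncard < F.graph.edgeSet.ncard)
    (p : ℕ → unitInterval) :
    (∀ t : ℕ → ℝ, (∀ n, 0 ≤ t n) →
      (∃ c : ℝ, 0 < c ∧ ∀ᶠ n : ℕ in atTop, c ≤ F.Phi n (p n)) →
      (∃ c : ℝ, 0 < c ∧ ∀ᶠ n : ℕ in atTop,
        (n : ℝ) ^ c ≤ (t n / F.mu n (p n)) ^ 2 * F.Phi n (p n)) →
      Tendsto (fun n : ℕ => (SimpleGraph.binomialRandom (Fin n) (p n)).real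
        {Γ | F.maxDeviation n (p n) Γ < t n}) atTop (𝓝 1) ∧
      ∀ τ : ℝ, 0 < τ →
        (fun n : ℕ => 1 - (SimpleGraph.binomialRandom (Fin n) (p n)).real
          {Γ | F.maxDeviation n (p n) Γ < t n}) =o[atTop] (fun n : ℕ => (n : ℝ) ^ (-τ))) ∧
    (∀ ε : ℕ → ℝ, (∀ n, 0 < ε n ∧ ε n ≤ 1) →
      ((Tendsto (fun n : ℕ => F.Phi n (p n) * (1 - (p n : ℝ))) atTop atTop ∧
          Tendsto (fun n : ℕ => ε n ^ 2 * F.Phi n (p n) / (1 - (p n : ℝ))) atTop (𝓝 0)) ∨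
        Tendsto (fun n : ℕ => F.Phi n (p n)) atTop (𝓝 0)) →
      Tendsto (fun n : ℕ => (SimpleGraph.binomialRandom (Fin n) (p n)).real
        {Γ | ε n * F.mu n (p n) ≤ F.maxDeviation n (p n) Γ}) atTop (𝓝 1)) := by
  refine ⟨fun t ht hΦ htΦ => ?_, fun ε hε h => ?_⟩
  · have hlit := F.isLittleO_one_sub_real_maxDeviation_lt hF p t ht hΦ htΦ
    refine ⟨?_, fun τ _ => hlit τ⟩
    -- The exponent τ = 0 gives failure probability o(1), which is the plain limit statement.
    have h0 := hlit 0
    simp only [neg_zero, Real.rpow_zero] at h0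
    have h1 := (Asymptotics.isLittleO_one_iff ℝ).1 h0
    simpa using h1.const_sub 1
  · rcases h with ⟨hΦ, hεΦ⟩ | hΦ
    · exact F.tendsto_real_le_maxDeviation_of_tendsto_atTop hF p ε (fun n => (hε n).1) hΦ hεΦ
    · exact F.tendsto_real_le_maxDeviation_of_Phi_tendsto_zero hF p ε (fun n => (hε n).2) hΦ
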